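/- Let $E\to M$ be a smooth real vector bundle (of finite rank) over a smooth manifold, and let $A_0=\bigoplus_{i\ge 0}\Gamma(M,\wedge^iE)$ be the $\mathbb Z$-graded commutative $\mathbb R$-algebra of smooth sections of its exterior algebra, with $A_0^j=\Gamma(M,\wedge^jE)$ ($A_0^j=0$ for $j<0$). Write $|a|$ for the degree of a homogeneous element, and grade $A=A_0[[\epsilon]]$ by $A^j=A_0^j[[\epsilon]]$. Let $(\mu_n)_{n\ge 0}$ be a (possibly curved) $A_\infty$-structure on $A$ over $\mathbb R[[\epsilon]]$: the $\mu_n\colon A^{n}\to A$ are $\mathbb R[[\epsilon]]$-multilinear of degree $2-n$, and for all $n\ge0$ and homogeneous $a_1,\dots,a_n\in A$ $$\sum_{q=0}^n(-1)^{q(n-q)}\sum_{j=0}^{n-q}(-1)^{(q-1)j+q\sum_{i=1}^j|a_i|}\,\mu_{n-q+1}\bigl(a_1,\dots,a_j,\mu_q(a_{j+1},\dots,a_{j+q}),a_{j+q+1},\dots,a_n\bigr)=0 .$$ Assume that $(\mu_n)$ reduces modulo $\epsilon$ to the product of $A_0=A/\epsilon A$, that is, $\mu_2(a,b)\equiv ab$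 and $\mu_n\equiv0$ modulo $\epsilon$ for $n\ne2$; and that the $\mu_n$ are multidifferential operators: in $\mu_n(a_1,\dots,a_n)=\sum_{k\ge0}\epsilon^k\mu_n^{k}(a_1,\dots,a_n)$ ($a_i\in A_0$), each $\mu_n^k\colon A_0^{n}\to A_0$ is a finite sum of maps $(a_1,\dots,a_n)\mapsto c\,D_1(a_1)\cdots D_n(a_n)$, where $c\in A_0$ and the $D_i$ are in the algebra of operators on $A_0$ generated by the left multiplications by elements of $A_0$ and the graded derivations of $A_0$. Let $S_n$ act on tensors with Koszul signs, so that $\sum_{\sigma\in S_n}\mathrm{sign}(\sigma)\,\sigma$ sends $a_1\otimes\dots\otimes a_n$ to $\sum_\sigma \mathrm{sign}(\sigma)\,\varepsilon(\sigma;a)\,a_{\sigma(1)}\otimes\dots\otimes a_{\sigma(n)}$ with $\varepsilon(\sigma;a)=\prod_{i<j,\ \sigma(i)>\sigma(j)}(-1)^{|a_{\sigma(i)}||a_{\sigma(j)}|}$. Then $\mu_n\circ\sum_{\sigma\in S_n}\mathrm{sign}(\sigma)\,\sigma$ takes values in $\epsilon A$, the maps $$\lambda_n=\frac1\epsilon\,\mu_n\circ\sum_{\sigma\in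 S_n}\mathrm{sign}(\sigma)\,\sigma\ \bmod \epsilon A,\qquad n\ge0,$$ are well-defined $\mathbb R$-multilinear maps $A_0^{n}\to A_0$, and $(\lambda_n)_{n\ge0}$ is a $P_\infty$-structure on the graded commutative algebra $A_0$. This means that $\lambda_n$ has degree $2-n$ and that, for homogeneous arguments: (i) $\lambda_n(\dots,a_i,a_{i+1},\dots)=-(-1)^{|a_i||a_{i+1}|}\lambda_n(\dots,a_{i+1},a_i,\dots)$; (ii) for $n\ge1$, the map $\varphi\colon a\mapsto\lambda_n(a_1,\dots,a_{n-1},a)$ is a derivation of degree $d=2-n+\sum_{i=1}^{n-1}|a_i|$, i.e. it has degree $d$ and $\varphi(ab)=\varphi(a)b+(-1)^{d|a|}a\varphi(b)$; (iii) for all $n\ge0$, the map $a_1\otimes\dots\otimes a_n\mapsto\sum_{q=0}^n\frac{(-1)^{q(n-q)}}{q!\,(n-q)!}\lambda_{n-q+1}\bigl(\lambda_q(a_1,\dots,a_q),a_{q+1},\dots,a_n\bigr)$ vanishes on the image of $\mathrm{Alt}_n=\frac1{n!}\sum_{\sigma\in S_n}\mathrm{sign}(\sigma)\,\sigma$. 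-/

import Mathlib

open scoped Manifold ContDiff

noncomputable section

namespace GradedHomotopy

/-! ### Graded commutative algebras and the alternation map -/

section Graded

variable {k : Type*} [Field k] {A : Type*} [Ring A] [Algebra k A]

/-- `A = ⨁ j, 𝒜 j` is a `ℤ`-graded commutative algebra over `k`. -/
structure IsGradedCommutative (𝒜 : ℤ → Submodule k A) : Prop where
  isInternal : DirectSum.IsInternal 𝒜
  one_mem : (1 : A) ∈ 𝒜 0
  mul_mem : ∀ (i j : ℤ), ∀ a ∈ 𝒜 i, ∀ b ∈ 𝒜 j, a * b ∈ 𝒜 (i + j)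
  mul_comm : ∀ (i j : ℤ), ∀ a ∈ 𝒜 i, ∀ b ∈ 𝒜 j, a * b = (i * j).negOnePow • (b * a)

/-- `φ` is a derivation of degree `e` of the graded algebra `A`:
`φ (a b) = φ a * b + (-1) ^ (e |a|) a * φ b`. -/
structure IsGradedDerivation (𝒜 : ℤ → Submodule k A) (e : ℤ) (φ : A →ₗ[k] A) : Prop where
  map_mem : ∀ j : ℤ, ∀ a ∈ 𝒜 j, φ a ∈ 𝒜 (j + e)
  leibniz : ∀ j : ℤ, ∀ a ∈ 𝒜 j, ∀ b : A,
    φ (a * b) = φ a * b + (e * j).negOnePow • (a * φ b)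

/-- The algebra of differential operators on `A`: the operators generated by the multiplications
by elements of `A` and by the (homogeneous) derivations of `A`. -/
def differentialOperators (𝒜 : ℤ → Submodule k A) : Subalgebra k (Module.End k A) :=
  Algebra.adjoin k
    ({D | ∃ c : A, D = LinearMap.mulLeft k c} ∪ {D | ∃ e : ℤ, IsGradedDerivation 𝒜 e D})

/-- The `n`-ary multidifferential operators on `A`: the finite sums of maps
`(a₁, …, aₙ) ↦ c * D₁ a₁ * ⋯ * Dₙ aₙ`, with `c ∈ A` and differential operators `Dᵢ`. -/
def multidifferentialOperators (𝒜 : ℤ → Submodule k A) (n : ℕ) :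
    Submodule k ((Fin n → A) → A) :=
  Submodule.span k
    {f | ∃ (c : A) (D : Fin n → Module.End k A), (∀ i, D i ∈ differentialOperators 𝒜) ∧
      f = fun a => c * (List.ofFn fun i => D i (a i)).prod}

/-- The Koszul sign `ε` of `a₁ ⊗ ⋯ ⊗ aₙ ↦ ε a_{σ 1} ⊗ ⋯ ⊗ a_{σ n}` for homogeneous `aᵢ` of
degrees `d i`: a factor `(-1) ^ (|a||b|)` for each pair `a`, `b` whose order is reversed. -/
def koszulSign {n : ℕ} (d : Fin n → ℤ) (σ : Equiv.Perm (Fin n)) : ℤˣ :=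
  ∏ i : Fin n, ∏ j : Fin n, if i < j ∧ σ j < σ i then (d (σ i) * d (σ j)).negOnePow else 1

/-- `f ∘ ∑ σ, sign σ • σ` on a tuple `a` of homogeneous elements of degrees `d`, where the
symmetric group acts on tensors with Koszul signs. -/
def alternationSum {V W : Type*} [AddCommGroup W] {n : ℕ} (d : Fin n → ℤ)
    (f : (Fin n → V) → W) (a : Fin n → V) : W :=
  ∑ σ : Equiv.Perm (Fin n), (Equiv.Perm.sign σ * koszulSign d σ) • f (a ∘ σ)

end Graded

/-! ### `A∞`-structures -/

/-- `(μ n)` is a (possibly curved) `A∞`-structure on the graded `R`-module `V` with homogeneous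
components `𝒱 j`. In the relations only `a 0, …, a (n - 1)` occur; they stand for
`a₁, …, aₙ`. -/
structure IsAInfinity {R V : Type*} [CommRing R] [AddCommGroup V] [Module R V]
    (𝒱 : ℤ → Submodule R V) (μ : ∀ n : ℕ, MultilinearMap R (fun _ : Fin n => V) V) : Prop where
  map_mem : ∀ (n : ℕ) (d : Fin n → ℤ) (a : Fin n → V), (∀ i, a i ∈ 𝒱 (d i)) →
    μ n a ∈ 𝒱 (∑ i, d i + 2 - n)
  relation : ∀ (n : ℕ) (d : ℕ → ℤ) (a : ℕ → V), (∀ i < n, a i ∈ 𝒱 (d i)) →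
    ∑ q ∈ Finset.range (n + 1), (q * (n - q) : ℤ).negOnePow •
      ∑ j ∈ Finset.range (n - q + 1),
        ((q - 1) * j + (∑ i ∈ Finset.range j, d i) * q : ℤ).negOnePow •
          μ (n - q + 1) (fun i : Fin (n - q + 1) =>
            if (i : ℕ) < j then a i
            else if (i : ℕ) = j then μ q (fun l : Fin q => a (j + l))
            else a (i + q - 1)) = 0

/-! ### `P∞`-structures -/

section PInfinity

variable {k : Type*} [Field k] {A : Type*} [Ring A] [Algebra k A]

/-- The map `(a₁, …, aₙ) ↦
∑_{q = 0}^{n} (-1)^{q (n-q)} / (q! (n-q)!) λ_{n-q+1} (λ_q (a₁, …, a_q), a_{q+1}, …, aₙ)`. -/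
def jacobiator (l : ∀ n : ℕ, MultilinearMap k (fun _ : Fin n => A) A) (n : ℕ)
    (a : Fin n → A) : A :=
  ∑ q : Fin (n + 1), ((-1 : k) ^ ((q : ℕ) * (n - q)) / (q.val.factorial * (n - q).factorial)) •
    l (n - q + 1) (Fin.cons
      (l q (fun i : Fin q => a ⟨i, by have := q.2; have := i.2; omega⟩))
      (fun i : Fin (n - q) => a ⟨q + i, by have := q.2; have := i.2; omega⟩))

/-- `(l n)` is a (possibly curved) `P∞`-structure on `A = ⨁ j, 𝒜 j`: this is a graded commutative
algebra, and the `l n`, of degree `2 - n`, are graded skew-symmetric, are derivations in the last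
argument, and satisfy the `L∞` Jacobi identities. -/
structure IsPInfinity (𝒜 : ℤ → Submodule k A)
    (l : ∀ n : ℕ, MultilinearMap k (fun _ : Fin n => A) A) : Prop where
  gradedCommutative : IsGradedCommutative 𝒜
  map_mem : ∀ (n : ℕ) (d : Fin n → ℤ) (a : Fin n → A), (∀ i, a i ∈ 𝒜 (d i)) →
    l n a ∈ 𝒜 (∑ i, d i + 2 - n)
  skew : ∀ (n : ℕ) (d : Fin n → ℤ) (a : Fin n → A), (∀ i, a i ∈ 𝒜 (d i)) →
    ∀ i j : Fin n, (i : ℕ) + 1 = j →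
      l n a = -((d i * d j).negOnePow • l n (a ∘ Equiv.swap i j))
  derivation : ∀ (n : ℕ) (d : Fin n → ℤ) (a : Fin n → A), (∀ i, a i ∈ 𝒜 (d i)) →
    IsGradedDerivation 𝒜 (2 - (n + 1 : ℕ) + ∑ i, d i)
      ((l (n + 1)).toLinearMap (Fin.snoc a 0) (Fin.last n))
  jacobi : ∀ (n : ℕ) (d : Fin n → ℤ) (a : Fin n → A), (∀ i, a i ∈ 𝒜 (d i)) →
    ((n.factorial : k)⁻¹) • alternationSum d (jacobiator l n) a = 0

end PInfinity

/-! ### Formal power series `A[[ε]]` as a module over `k[[ε]]` -/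

section FormalSeries

/-- Formal power series `∑ aᵢ εⁱ` with coefficients in `A`. -/
def FormalSeries (A : Type*) : Type _ := PowerSeries A

variable {k : Type*} [Field k] {A : Type*} [Ring A] [Algebra k A]

instance : AddCommGroup (FormalSeries A) := inferInstanceAs (AddCommGroup (PowerSeries A))

/-- `k[[ε]]` acts on `A[[ε]]` by the Cauchy product. -/
instance : Module (PowerSeries k) (FormalSeries A) :=
  Module.compHom (PowerSeries A) (PowerSeries.map (algebraMap k A))

/-- The coefficient of `εⁱ`. -/
def FormalSeries.coeff (i : ℕ) (a : FormalSeries A) : A := PowerSeries.coeff (R := A) i a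

/-- Elements of `A` as constant series. -/
def FormalSeries.const (a : A) : FormalSeries A := PowerSeries.C (R := A) a

/-- `A[[ε]]` is graded by `(A[[ε]])ʲ = Aʲ[[ε]]`, with `ε` of degree `0`. -/
def FormalSeries.grading (𝒜 : ℤ → Submodule k A) (j : ℤ) :
    Submodule (PowerSeries k) (FormalSeries A) where
  carrier := {a | ∀ i, FormalSeries.coeff i a ∈ 𝒜 j}
  zero_mem' := fun i => by
    have : FormalSeries.coeff i (0 : FormalSeries A) = 0 :=
      map_zero (PowerSeries.coeff (R := A) i)
    rw [this]
    exact (𝒜 j).zero_mem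
  add_mem' := fun {a b} ha hb i => by
    have : FormalSeries.coeff i (a + b) = FormalSeries.coeff i a + FormalSeries.coeff i b :=
      map_add (PowerSeries.coeff (R := A) i) _ _
    rw [this]
    exact (𝒜 j).add_mem (ha i) (hb i)
  smul_mem' := fun c a ha i => by
    have : FormalSeries.coeff i (c • a) = ∑ p ∈ Finset.HasAntidiagonal.antidiagonal i,
        PowerSeries.coeff p.1 c • FormalSeries.coeff p.2 a := by
      refine (PowerSeries.coeff_mul (R := A) i (PowerSeries.map (algebraMap k A) c) a).trans ?_
      refine Finset.sum_congr rfl fun p _ => ?_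
      rw [PowerSeries.coeff_map, ← Algebra.smul_def]
      rfl
    rw [this]
    exact (𝒜 j).sum_mem fun p _ => (𝒜 j).smul_mem _ (ha p.2)

/-- The `k[[ε]]`-multilinear operations `μ n` on `A[[ε]]` reduce modulo `ε` to the product of
`A = A[[ε]] / ε A[[ε]]`, i.e. to `μ₂ = ` product and `μₙ = 0` for `n ≠ 2`. -/
def ReducesToProduct
    (μ : ∀ n : ℕ, MultilinearMap (PowerSeries k) (fun _ : Fin n => FormalSeries A)
      (FormalSeries A)) : Prop :=
  (∀ a : Fin 2 → FormalSeries A, (μ 2 a).coeff 0 = (a 0).coeff 0 * (a 1).coeff 0) ∧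
  ∀ n : ℕ, n ≠ 2 → ∀ a : Fin n → FormalSeries A, (μ n a).coeff 0 = 0

/-- The operations `μ n = ∑ i, εⁱ μ n i` are multidifferential operators: each coefficient `μ n i`,
a map `Aⁿ → A`, is one. -/
def IsMultidifferential (𝒜 : ℤ → Submodule k A)
    (μ : ∀ n : ℕ, MultilinearMap (PowerSeries k) (fun _ : Fin n => FormalSeries A)
      (FormalSeries A)) : Prop :=
  ∀ n i : ℕ, (fun a : Fin n → A => (μ n fun j => FormalSeries.const (a j)).coeff i) ∈
    multidifferentialOperators 𝒜 n

/-- `λₙ = (1/ε) μₙ ∘ (∑ σ, sign σ • σ) mod ε A[[ε]]`, as maps on `A = A[[ε]] / ε A[[ε]]`: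
for homogeneous `aᵢ ∈ A[[ε]]`, the element `μₙ (∑ σ, sign σ • σ (a₁ ⊗ ⋯ ⊗ aₙ))` is
divisible by `ε`, and its quotient by `ε` reduces to `λₙ` of the reductions of the `aᵢ`. -/
def IsFirstOrderAlternation (𝒜 : ℤ → Submodule k A)
    (μ : ∀ n : ℕ, MultilinearMap (PowerSeries k) (fun _ : Fin n => FormalSeries A)
      (FormalSeries A))
    (l : ∀ n : ℕ, MultilinearMap k (fun _ : Fin n => A) A) : Prop :=
  ∀ (n : ℕ) (d : Fin n → ℤ) (a : Fin n → FormalSeries A),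
    (∀ i, a i ∈ FormalSeries.grading 𝒜 (d i)) →
    ∃ b : FormalSeries A, alternationSum d (μ n) a = (PowerSeries.X : PowerSeries k) • b ∧
      b.coeff 0 = l n (fun i => (a i).coeff 0)

end FormalSeries

/-! ### The algebra of smooth sections of the exterior algebra of a vector bundle -/

section Sections

variable {EM : Type*} [NormedAddCommGroup EM] [NormedSpace ℝ EM]
  {H : Type*} [TopologicalSpace H] (I : ModelWithCorners ℝ EM H)
  {M : Type*} [TopologicalSpace M] [ChartedSpace H M]
  (F : Type*) [NormedAddCommGroup F] [NormedSpace ℝ F] [FiniteDimensional ℝ F]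
  (E : M → Type*) [∀ x, AddCommGroup (E x)] [∀ x, Module ℝ (E x)] [∀ x, TopologicalSpace (E x)]
  [TopologicalSpace (Bundle.TotalSpace F E)] [FiberBundle F E] [VectorBundle ℝ F E]

/-- A section `s` of `∧E` read in the local trivialization of `E` around `p`: a function with values
in the exterior algebra of the model fibre. -/
def localForm (s : ∀ x, ExteriorAlgebra ℝ (E x)) (p x : M) : ExteriorAlgebra ℝ F :=
  ExteriorAlgebra.map ((trivializationAt F E p).linearMapAt ℝ x) (s x)

/-- A section of `∧E` is smooth if its coordinates in local trivializations of `E` are. (The model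
fibre `ExteriorAlgebra ℝ F` is finite dimensional, so all coordinates are smooth iff all linear
functionals of the local form are.) -/
def IsSmoothSection (s : ∀ x, ExteriorAlgebra ℝ (E x)) : Prop :=
  ∀ (p : M) (φ : ExteriorAlgebra ℝ F →ₗ[ℝ] ℝ),
    ContMDiffOn I 𝓘(ℝ, ℝ) ∞ (fun x => φ (localForm F E s p x)) (trivializationAt F E p).baseSet

variable {F E} in
theorem IsSmoothSection.mul {s t : ∀ x, ExteriorAlgebra ℝ (E x)}
    (hs : IsSmoothSection I F E s) (ht : IsSmoothSection I F E t) :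
    IsSmoothSection I F E (s * t) := by
  intro p φ
  let b := (Module.finBasis ℝ F).ExteriorAlgebra
  have key : ∀ x, φ (localForm F E (s * t) p x) =
      ∑ i, ∑ j, b.coord i (localForm F E s p x) * b.coord j (localForm F E t p x) *
        φ (b i * b j) := by
    intro x
    have h1 : localForm F E (s * t) p x = localForm F E s p x * localForm F E t p x :=
      map_mul _ _ _
    rw [h1]
    conv_lhs => rw [← b.sum_repr (localForm F E s p x), ← b.sum_repr (localForm F E t p x)]
    simp only [Finset.sum_mul, Finset.mul_sum, map_sum, smul_mul_smul_comm, map_smul,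
      smul_eq_mul, Module.Basis.coord_apply]
    rw [Finset.sum_comm]
  simp only [key]
  refine contMDiffOn_finsetSum fun i _ => contMDiffOn_finsetSum fun j _ => ?_
  exact ((hs p (b.coord i)).mul (ht p (b.coord j))).mul contMDiffOn_const

/-- `A₀ = Γ(M, ∧E)`, the algebra of smooth sections of `∧E` with the pointwise product. -/
def sectionAlgebra : Subalgebra ℝ (∀ x, ExteriorAlgebra ℝ (E x)) where
  carrier := {s | IsSmoothSection I F E s}
  mul_mem' := fun hs ht => hs.mul I ht
  add_mem' := fun {s t} hs ht p φ => by
    refine ((hs p φ).add (ht p φ)).congr fun x _ => ?_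
    simp [localForm]
  algebraMap_mem' := fun r p φ => by
    refine (contMDiffOn_const (c := φ (algebraMap ℝ _ r))).congr fun x _ => ?_
    simp [localForm]

/-- The degree `j` part `Γ(M, ∧ʲE)` of `Γ(M, ∧E)`, which is `0` for `j < 0`. -/
def sectionGrading (j : ℤ) : Submodule ℝ (sectionAlgebra I F E) where
  carrier := {s | ∀ x, s.1 x ∈ if 0 ≤ j then ⋀[ℝ]^j.toNat (E x) else ⊥}
  zero_mem' := fun _ => Submodule.zero_mem _
  add_mem' := fun hs ht x => Submodule.add_mem _ (hs x) (ht x)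
  smul_mem' := fun c _ hs x => Submodule.smul_mem _ c (hs x)

end Sections

end GradedHomotopy

end

/-! Write μ = m + ε f + ε² g + …, where m is the product and sits in arity 2 only. The coefficients
of ε and ε² in the A∞ relations read δf = 0 and f ∘ f + δg = 0, where ∘ is the signed sum of all
insertions and δ is, up to sign, the Hochschild coboundary of the product. As m has a single arity,
the first equation holds arity by arity: every fₙ is a Hochschild cocycle. The bracket λₙ is the
alternation of fₙ.

Everything then follows from the behaviour of alternation over a graded commutative algebra. The
product alternates to zero, so the alternation of μₙ is divisible by ε, and its quotient modulo ε
depends only on the arguments modulo ε (`coeff_one_alternationSum`). A coboundary alternates to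
zero: its two outer terms are exchanged by a rotation of the word, and merging ab cancels against
merging ba (`alternation_hochschildCoboundary`). The Jacobiator of λ and f ∘ f have the same
alternation (`alternation_jacobiator`); since f ∘ f = -δg, this is the Jacobi identity. For the
Leibniz rule, δf = 0 is summed only over the words in which b precedes c. The cancellations above
break down exactly where the order of b and c would change; what survives is f alternated on bc, b
times f alternated on c, and f alternated on b times c (`alternate_mul_cons`).

The algebra of sections enters through its graded commutativity
(`sectionGrading_isGradedCommutative`) and because finite rank leaves finitely many nonzero degrees.
The signs in λₙ depend on degrees, so λₙ is first given on homogeneous words and then extended as a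
finite sum over degree vectors (`exists_alternate`). -/

noncomputable section

namespace GradedHomotopy

/-! ### Signs of permutations of graded letters -/

section AltSign

/-- The sign `-(-1)^(i j)` of the graded skew-symmetric exchange of elements of degrees `i`, `j`. -/
def exchangeSign (i j : ℤ) : ℤˣ := -(i * j).negOnePow

theorem exchangeSign_comm (i j : ℤ) : exchangeSign i j = exchangeSign j i := by
  rw [exchangeSign, exchangeSign, mul_comm]

theorem exchangeSign_eq (i j : ℤ) : exchangeSign i j = (1 + i * j).negOnePow := by
  rw [exchangeSign, add_comm, Int.negOnePow_succ]

/-- The sign of a permutation times its Koszul sign. -/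
def altSign {n : ℕ} (d : Fin n → ℤ) (σ : Equiv.Perm (Fin n)) : ℤˣ :=
  Equiv.Perm.sign σ * koszulSign d σ

theorem sign_eq_prod_inversions {n : ℕ} (σ : Equiv.Perm (Fin n)) :
    Equiv.Perm.sign σ = ∏ i : Fin n, ∏ j : Fin n, if i < j ∧ σ j < σ i then (-1 : ℤˣ) else 1 := by
  rw [σ.sign_eq_prod_prod_Iio, Finset.prod_comm]
  refine Finset.prod_congr rfl fun j _ => ?_
  rw [← Finset.prod_subset (Finset.subset_univ (Finset.Iio j))]
  · refine Finset.prod_congr rfl fun i hi => ?_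
    have hij : i < j := Finset.mem_Iio.1 hi
    have : σ i ≠ σ j := fun h => hij.ne (σ.injective h)
    by_cases h : σ i < σ j
    · simp [h, h.not_gt]
    · simp [h, hij, lt_of_le_of_ne (not_lt.1 h) this.symm]
  · intro i _ hi
    rw [if_neg fun h => hi (Finset.mem_Iio.2 h.1)]

theorem altSign_eq_prod {n : ℕ} (d : Fin n → ℤ) (σ : Equiv.Perm (Fin n)) :
    altSign d σ = ∏ i : Fin n, ∏ j : Fin n,
      if i < j ∧ σ j < σ i then exchangeSign (d (σ i)) (d (σ j)) else 1 := by
  rw [altSign, sign_eq_prod_inversions, koszulSign, ← Finset.prod_mul_distrib]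
  refine Finset.prod_congr rfl fun i _ => ?_
  rw [← Finset.prod_mul_distrib]
  refine Finset.prod_congr rfl fun j _ => ?_
  split_ifs <;> simp [exchangeSign]

/-- A symmetric function makes the product run over unordered pairs, and τ only permutes these. -/
theorem prod_prod_lt_comp_perm {n : ℕ} (h : Fin n → Fin n → ℤˣ) (hs : ∀ i j, h i j = h j i)
    (τ : Equiv.Perm (Fin n)) :
    (∏ i, ∏ j, if i < j then h (τ i) (τ j) else 1) = ∏ i, ∏ j, if i < j then h i j else 1 := by
  -- Antisymmetrizing h brings in the known formula for antisymmetric functions. The sign of τ it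
  -- produces reappears when g is rewritten through h, and cancels.
  let g : Fin n → Fin n → ℤ := fun i j =>
    if i < j then (h i j : ℤ) else if j < i then -(h i j : ℤ) else 0
  have hg : ∀ i j, g i j = -g j i := by
    intro i j
    simp only [g]
    rcases lt_trichotomy i j with hij | hij | hij
    · simp [hij, hij.not_gt, hs i j]
    · simp [hij]
    · simp [hij, hij.not_gt, hs i j]
  have key := τ.prod_Iio_comp_eq_sign_mul_prod hg
  have e1 : ∀ k : Fin n → Fin n → ℤˣ, (∏ i, ∏ j, if i < j then k i j else 1) =
      ∏ j, ∏ i ∈ Finset.Iio j, k i j := by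
    intro k
    rw [Finset.prod_comm]
    refine Finset.prod_congr rfl fun j _ => ?_
    rw [← Finset.prod_filter]
    refine Finset.prod_congr ?_ fun _ _ => rfl
    ext i; simp
  rw [e1 h, e1 fun i j => h (τ i) (τ j)]
  have e2 : ∏ j, ∏ i ∈ Finset.Iio j, g i j =
      ((∏ j, ∏ i ∈ Finset.Iio j, h i j : ℤˣ) : ℤ) := by
    rw [Units.coe_prod]
    refine Finset.prod_congr rfl fun j _ => ?_
    rw [Units.coe_prod]
    refine Finset.prod_congr rfl fun i hi => ?_
    simp [g, Finset.mem_Iio.1 hi]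
  have e3 : ∏ j, ∏ i ∈ Finset.Iio j, g (τ i) (τ j) =
      (((Equiv.Perm.sign τ) * ∏ j, ∏ i ∈ Finset.Iio j, h (τ i) (τ j) : ℤˣ) : ℤ) := by
    rw [τ.sign_eq_prod_prod_Iio, ← Finset.prod_mul_distrib, Units.coe_prod]
    refine Finset.prod_congr rfl fun j _ => ?_
    rw [← Finset.prod_mul_distrib, Units.coe_prod]
    refine Finset.prod_congr rfl fun i hi => ?_
    have hij : i < j := Finset.mem_Iio.1 hi
    have : τ i ≠ τ j := fun h => hij.ne (τ.injective h)
    by_cases h : τ i < τ j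
    · simp [g, h]
    · simp [g, h, lt_of_le_of_ne (not_lt.1 h) this.symm]
  rw [e2, e3] at key
  have key' : Equiv.Perm.sign τ * ∏ j, ∏ i ∈ Finset.Iio j, h (τ i) (τ j) =
      Equiv.Perm.sign τ * ∏ j, ∏ i ∈ Finset.Iio j, h i j := by
    apply Units.ext
    simpa using key
  exact mul_left_cancel key'

/-- A pair is inverted by σ * τ exactly when one, but not both, of τ on the pair and σ on its image
inverts it; if both do, the factor occurs squared and is 1. -/
theorem altSign_mul {n : ℕ} (d : Fin n → ℤ) (σ τ : Equiv.Perm (Fin n)) :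
    altSign d (σ * τ) = altSign d σ * altSign (fun i => d (σ i)) τ := by
  -- The factor of an unordered pair in the sign of σ; its symmetry allows reindexing along τ.
  let h : Fin n → Fin n → ℤˣ := fun i j =>
    if (i < j ∧ σ j < σ i) ∨ (j < i ∧ σ i < σ j) then exchangeSign (d (σ i)) (d (σ j)) else 1
  have hs : ∀ i j, h i j = h j i := by
    intro i j
    simp only [h, exchangeSign_comm (d (σ i))]
    congr 1
    rw [or_comm]
  have h1 : altSign d σ = ∏ i, ∏ j, if i < j then h i j else 1 := by
    rw [altSign_eq_prod]
    refine Finset.prod_congr rfl fun i _ => Finset.prod_congr rfl fun j _ => ?_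
    by_cases hij : i < j
    · simp [h, hij, hij.not_gt]
    · simp [hij]
  rw [h1, ← prod_prod_lt_comp_perm h hs τ, altSign_eq_prod, altSign_eq_prod,
    ← Finset.prod_mul_distrib]
  refine Finset.prod_congr rfl fun i _ => ?_
  rw [← Finset.prod_mul_distrib]
  refine Finset.prod_congr rfl fun j _ => ?_
  by_cases hij : i < j
  · have h2 : τ i ≠ τ j := fun h => hij.ne (τ.injective h)
    have h3 : σ (τ i) ≠ σ (τ j) := fun h => h2 (σ.injective h)
    rcases lt_or_gt_of_ne h2 with h4 | h4 <;> rcases lt_or_gt_of_ne h3 with h5 | h5 <;>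
      simp [h, hij, h4, h4.not_gt, h5, h5.not_gt]
  · simp [hij]

end AltSign

/-! ### Alternation sums over words -/

section Alternation

variable {P W : Type*} [AddCommGroup W] {n : ℕ}

theorem alternationSum_eq (d : Fin n → ℤ) (Φ : (Fin n → P) → W) (x : Fin n → P) :
    alternationSum d Φ x = ∑ σ : Equiv.Perm (Fin n), altSign d σ • Φ (x ∘ σ) := rfl

variable (deg : P → ℤ)

/-- The alternation sum on words in letters with prescribed degrees. -/
def alternation (Φ : (Fin n → P) → W) (x : Fin n → P) : W :=
  ∑ σ : Equiv.Perm (Fin n), altSign (deg ∘ x) σ • Φ (x ∘ σ)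

/-- The action with Koszul signs of a permutation on functions of words. -/
def signedReindex (κ : Equiv.Perm (Fin n)) (Φ : (Fin n → P) → W) (x : Fin n → P) : W :=
  altSign (deg ∘ x) κ • Φ (x ∘ κ)

theorem signed_term_mul (Φ : (Fin n → P) → W) (x : Fin n → P) (σ κ : Equiv.Perm (Fin n)) :
    altSign (deg ∘ x) (σ * κ) • Φ (x ∘ ⇑(σ * κ)) =
      altSign (deg ∘ x) σ • signedReindex deg κ Φ (x ∘ σ) := by
  rw [altSign_mul, mul_smul]
  rfl

/-- Right translation by κ permutes the summands. This is the source of all later cancellations: a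
term may be replaced by any signed rearrangement of itself. -/
theorem alternation_signedReindex (κ : Equiv.Perm (Fin n)) (Φ : (Fin n → P) → W) (x : Fin n → P) :
    alternation deg (signedReindex deg κ Φ) x = alternation deg Φ x := by
  simp only [alternation, ← signed_term_mul]
  exact Equiv.sum_comp (Equiv.mulRight κ) fun σ => altSign (deg ∘ x) σ • Φ (x ∘ ⇑σ)

/-- Left translation by κ; this is the graded skew-symmetry of an alternation. -/
theorem alternation_comp_perm (κ : Equiv.Perm (Fin n)) (Φ : (Fin n → P) → W) (x : Fin n → P) :
    altSign (deg ∘ x) κ • alternation deg Φ (x ∘ κ) = alternation deg Φ x := by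
  rw [alternation, alternation, Finset.smul_sum]
  refine Eq.trans ?_ (Equiv.sum_comp (Equiv.mulLeft κ) fun σ => altSign (deg ∘ x) σ • Φ (x ∘ ⇑σ))
  refine Finset.sum_congr rfl fun σ _ => ?_
  rw [Equiv.coe_mulLeft, altSign_mul, mul_smul]
  rfl

theorem alternation_add (Φ Ψ : (Fin n → P) → W) (x : Fin n → P) :
    alternation deg (fun y => Φ y + Ψ y) x = alternation deg Φ x + alternation deg Ψ x := by
  simp only [alternation, smul_add, Finset.sum_add_distrib]

theorem alternation_neg (Φ : (Fin n → P) → W) (x : Fin n → P) :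
    alternation deg (fun y => -Φ y) x = -alternation deg Φ x := by
  simp only [alternation, smul_neg, Finset.sum_neg_distrib]

theorem alternation_sum {ι : Type*} (s : Finset ι) (Φ : ι → (Fin n → P) → W) (x : Fin n → P) :
    alternation deg (fun y => ∑ i ∈ s, Φ i y) x = ∑ i ∈ s, alternation deg (Φ i) x := by
  simp only [alternation, Finset.smul_sum]
  exact Finset.sum_comm

theorem alternation_smul {R : Type*} [Monoid R] [DistribMulAction R W] [SMulCommClass ℤˣ R W]
    (c : R) (Φ : (Fin n → P) → W) (x : Fin n → P) :
    alternation deg (fun y => c • Φ y) x = c • alternation deg Φ x := by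
  simp only [alternation, Finset.smul_sum]
  exact Finset.sum_congr rfl fun σ _ => smul_comm _ _ _

theorem alternation_eq_zero_of_signedReindex_eq_neg [IsAddTorsionFree W]
    (κ : Equiv.Perm (Fin n)) (Φ : (Fin n → P) → W) (h : ∀ y, signedReindex deg κ Φ y = -Φ y)
    (x : Fin n → P) : alternation deg Φ x = 0 := by
  have h1 := alternation_signedReindex deg κ Φ x
  rw [show signedReindex deg κ Φ = fun y => -Φ y from funext h, alternation_neg] at h1
  exact self_eq_neg.1 h1.symm


end Alternation

/-! ### Expanding a permutation by the position of one letter -/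

section Insertion

/-- The permutation whose word is the word `τ` in the letters `1, …, n`, with the letter `0`
inserted at the position `j`. -/
def insertPerm {n : ℕ} (j : Fin (n + 1)) (τ : Equiv.Perm (Fin n)) : Equiv.Perm (Fin (n + 1)) :=
  Equiv.Perm.decomposeFin.symm (0, τ) * j.cycleRange

theorem insertPerm_self {n : ℕ} (j : Fin (n + 1)) (τ : Equiv.Perm (Fin n)) :
    insertPerm j τ j = 0 := by
  simp [insertPerm]

theorem insertPerm_succAbove {n : ℕ} (j : Fin (n + 1)) (τ : Equiv.Perm (Fin n)) (i : Fin n) :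
    insertPerm j τ (j.succAbove i) = (τ i).succ := by
  simp [insertPerm]

theorem cons_comp_insertPerm {P : Type*} {n : ℕ} (j : Fin (n + 1)) (τ : Equiv.Perm (Fin n))
    (y : P) (w : Fin n → P) :
    (Fin.cons y w : Fin (n + 1) → P) ∘ insertPerm j τ = j.insertNth y (w ∘ τ) := by
  refine (Fin.insertNth_eq_iff.2 ⟨?_, ?_⟩).symm
  · simp [insertPerm_self]
  · funext i
    simp [Fin.removeNth, insertPerm_succAbove]

theorem insertPerm_bijective (n : ℕ) :
    Function.Bijective fun p : Fin (n + 1) × Equiv.Perm (Fin n) => insertPerm p.1 p.2 := by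
  rw [Fintype.bijective_iff_injective_and_card]
  constructor
  · rintro ⟨j, τ⟩ ⟨j', τ'⟩ h
    simp only at h
    have hj : j = j' := by
      apply (insertPerm j τ).injective
      rw [insertPerm_self, h, insertPerm_self]
    subst hj
    simpa [insertPerm] using h
  · simp [Fintype.card_perm, Nat.factorial_succ]

theorem sum_perm_succ_eq_sum_insertPerm {W : Type*} [AddCommMonoid W] {n : ℕ}
    (G : Equiv.Perm (Fin (n + 1)) → W) :
    ∑ σ, G σ = ∑ j, ∑ τ, G (insertPerm j τ) := by
  rw [← Fintype.sum_prod_type']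
  exact ((insertPerm_bijective n).sum_comp G).symm

theorem sum_perm_apply_eq_zero {W : Type*} [AddCommMonoid W] {n : ℕ}
    (G : Equiv.Perm (Fin (n + 1)) → W) (j : Fin (n + 1)) :
    (∑ σ, if σ j = 0 then G σ else 0) = ∑ τ, G (insertPerm j τ) := by
  rw [sum_perm_succ_eq_sum_insertPerm, Finset.sum_eq_single j]
  · simp [insertPerm_self]
  · intro j' _ hj'
    refine Finset.sum_eq_zero fun τ _ => if_neg fun h => hj' ?_
    apply (insertPerm j' τ).injective
    rw [insertPerm_self, h]
  · simp

/-- The sign of moving a letter of degree `e` past the first `j` letters of a word. -/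
def insertSign {n : ℕ} (j : Fin (n + 1)) (e : ℤ) (d : Fin n → ℤ) : ℤˣ :=
  ∏ i : Fin n, if i.castSucc < j then exchangeSign (d i) e else 1

/-- The letter 0 is inverted exactly with the letters standing before it; the remaining inversions
are those of τ. -/
theorem altSign_insertPerm {n : ℕ} (j : Fin (n + 1)) (τ : Equiv.Perm (Fin n))
    (e : ℤ) (d : Fin n → ℤ) :
    altSign (Fin.cons e d : Fin (n + 1) → ℤ) (insertPerm j τ) =
      altSign d τ * insertSign j e (d ∘ τ) := by
  rw [altSign_eq_prod, Fin.prod_univ_succAbove _ j]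
  have h1 : (∏ i : Fin (n + 1), if j < i ∧ insertPerm j τ i < insertPerm j τ j then
      exchangeSign ((Fin.cons e d : Fin (n + 1) → ℤ) (insertPerm j τ j))
        ((Fin.cons e d : Fin (n + 1) → ℤ) (insertPerm j τ i)) else 1) = 1 := by
    refine Finset.prod_eq_one fun i _ => if_neg ?_
    simp [insertPerm_self]
  rw [h1, one_mul, altSign_eq_prod, insertSign, ← Finset.prod_mul_distrib]
  refine Finset.prod_congr rfl fun i _ => ?_
  rw [Fin.prod_univ_succAbove _ j, mul_comm]
  congr 1
  · refine Finset.prod_congr rfl fun i' _ => ?_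
    simp [insertPerm_succAbove]
  · simp [insertPerm_self, insertPerm_succAbove, Fin.succAbove_lt_iff_castSucc_lt]

variable {P W : Type*} [AddCommGroup W] (deg : P → ℤ)

theorem comp_cons {n : ℕ} (y : P) (w : Fin n → P) :
    deg ∘ (Fin.cons y w : Fin (n + 1) → P) = (Fin.cons (deg y) (deg ∘ w) : Fin (n + 1) → ℤ) := by
  funext i
  refine Fin.cases ?_ (fun i => ?_) i <;> simp

/-- Expansion of an alternation sum by the position of the first letter. -/
theorem alternation_cons {n : ℕ} (Φ : (Fin (n + 1) → P) → W) (y : P) (w : Fin n → P) :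
    alternation deg Φ (Fin.cons y w : Fin (n + 1) → P) = alternation deg (fun w =>
      ∑ j : Fin (n + 1), insertSign j (deg y) (deg ∘ w) • Φ (j.insertNth y w)) w := by
  rw [alternation_sum, alternation, sum_perm_succ_eq_sum_insertPerm]
  refine Finset.sum_congr rfl fun j _ => Finset.sum_congr rfl fun τ _ => ?_
  rw [comp_cons, altSign_insertPerm, cons_comp_insertPerm, mul_smul]
  rfl

end Insertion

/-! ### Sign arithmetic and rotations -/

section Signs

theorem negOnePow_eq_of_sub_eq {a b : ℤ} (c : ℤ) (h : a - b = 2 * c) :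
    a.negOnePow = b.negOnePow :=
  (Int.negOnePow_eq_iff a b).2 ⟨c, by rw [h, two_mul]⟩

theorem units_smul_mul {A : Type*} [Ring A] (u : ℤˣ) (a b : A) : u • a * b = u • (a * b) := by
  rcases Int.units_eq_one_or u with rfl | rfl <;> simp [Units.neg_smul]

theorem mul_units_smul {A : Type*} [Ring A] (u : ℤˣ) (a b : A) : a * u • b = u • (a * b) := by
  rcases Int.units_eq_one_or u with rfl | rfl <;> simp [Units.neg_smul]

theorem map_units_smul {A B F : Type*} [AddCommGroup A] [AddCommGroup B] [FunLike F A B]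
    [AddMonoidHomClass F A B] (f : F) (u : ℤˣ) (a : A) : f (u • a) = u • f a := by
  rcases Int.units_eq_one_or u with rfl | rfl <;> simp [Units.neg_smul]

theorem prod_negOnePow {ι : Type*} (s : Finset ι) (d : ι → ℤ) :
    ∏ i ∈ s, (d i).negOnePow = (∑ i ∈ s, d i).negOnePow := by
  classical
  induction s using Finset.induction_on with
  | empty => simp
  | insert a s ha ih => rw [Finset.prod_insert ha, Finset.sum_insert ha, ih, Int.negOnePow_add]

theorem prod_exchangeSign {n : ℕ} (e : ℤ) (d : Fin n → ℤ) :
    ∏ i, exchangeSign (d i) e = (n + e * ∑ i, d i).negOnePow := by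
  simp only [exchangeSign_eq, prod_negOnePow, Finset.sum_add_distrib, Finset.mul_sum]
  simp [mul_comm]

theorem insertSign_zero {n : ℕ} (e : ℤ) (d : Fin n → ℤ) : insertSign 0 e d = 1 :=
  Finset.prod_eq_one fun _ _ => if_neg (Fin.not_lt_zero _)

theorem insertSign_last {n : ℕ} (e : ℤ) (d : Fin n → ℤ) :
    insertSign (Fin.last n) e d = (n + e * ∑ i, d i).negOnePow := by
  rw [← prod_exchangeSign]
  exact Finset.prod_congr rfl fun i _ => if_pos (Fin.castSucc_lt_last i)

theorem prod_castSucc_lt_neg_one {n : ℕ} (j : Fin (n + 1)) :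
    (∏ i : Fin n, if i.castSucc < j then (-1 : ℤˣ) else 1) = (j : ℤ).negOnePow := by
  rw [Finset.prod_ite, Finset.prod_const, Finset.prod_const_one, mul_one, Int.negOnePow_def,
    zpow_natCast]
  congr 1
  have : (Finset.univ.filter fun i : Fin n => i.castSucc < j) =
      Finset.univ.filter fun i : Fin n => (i : ℕ) < j := by
    ext i; simp [Fin.lt_def]
  rw [this, Fin.card_filter_val_lt]
  exact min_eq_right (Nat.lt_succ_iff.1 j.2)

/-- Two letters moved past j letters give two minus signs per letter passed, their product gives
only one. The defect (-1)^j is the sign of the j-th merging term of the Hochschild coboundary. -/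
theorem insertSign_mul {n : ℕ} (j : Fin (n + 1)) (e e' : ℤ) (d : Fin n → ℤ) :
    insertSign j e d * insertSign j e' d = (j : ℤ).negOnePow * insertSign j (e + e') d := by
  rw [← prod_castSucc_lt_neg_one, insertSign, insertSign, insertSign, ← Finset.prod_mul_distrib,
    ← Finset.prod_mul_distrib]
  refine Finset.prod_congr rfl fun i _ => ?_
  split_ifs
  · simp [exchangeSign, mul_add, Int.negOnePow_add]
  · simp

theorem insertSign_castSucc {n : ℕ} (j : Fin (n + 1)) (e e' : ℤ) (d : Fin n → ℤ) :
    insertSign j.castSucc e (j.insertNth e' d : Fin (n + 1) → ℤ) = insertSign j e d := by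
  rw [insertSign, Fin.prod_univ_succAbove _ j]
  simp [insertSign, Fin.succAbove_lt_iff_castSucc_lt]

theorem altSign_swap_adjacent {n : ℕ} (d : Fin (n + 1) → ℤ) (j : Fin n) :
    altSign d (Equiv.swap j.castSucc j.succ) = exchangeSign (d j.castSucc) (d j.succ) := by
  have key : ∀ a b : Fin (n + 1), (a < b ∧ Equiv.swap j.castSucc j.succ b <
      Equiv.swap j.castSucc j.succ a) ↔ (a = j.castSucc ∧ b = j.succ) := by
    intro a b
    simp only [Equiv.swap_apply_def, Fin.lt_def, Fin.ext_iff]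
    split_ifs <;> simp only [Fin.val_castSucc, Fin.val_succ] at * <;> omega
  rw [altSign_eq_prod, Finset.prod_eq_single j.castSucc, Finset.prod_eq_single j.succ]
  · rw [if_pos ((key _ _).2 ⟨rfl, rfl⟩), Equiv.swap_apply_left, Equiv.swap_apply_right,
      exchangeSign_comm]
  · intro b _ hb
    exact if_neg fun h => hb ((key _ _).1 h).2
  · simp
  · intro a _ ha
    exact Finset.prod_eq_one fun b _ => if_neg fun h => ha ((key _ _).1 h).1
  · simp

theorem multilinear_update_units_smul {k A : Type*} [CommRing k] [AddCommGroup A] [Module k A]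
    {n : ℕ} (f : MultilinearMap k (fun _ : Fin n => A) A) (m : Fin n → A) (i : Fin n) (u : ℤˣ)
    (a : A) : f (Function.update m i (u • a)) = u • f (Function.update m i a) := by
  rcases Int.units_eq_one_or u with rfl | rfl <;> simp [Units.neg_smul]

end Signs

/-- The rotation whose word is `1, …, n, 0`. -/
def rotatePerm (n : ℕ) : Equiv.Perm (Fin (n + 1)) := insertPerm (Fin.last n) 1

theorem cons_comp_rotatePerm {P : Type*} {n : ℕ} (y : P) (w : Fin n → P) :
    (Fin.cons y w : Fin (n + 1) → P) ∘ rotatePerm n = Fin.snoc w y := by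
  rw [rotatePerm, cons_comp_insertPerm, Fin.insertNth_last']
  rfl

theorem altSign_rotatePerm {n : ℕ} (e : ℤ) (d : Fin n → ℤ) :
    altSign (Fin.cons e d : Fin (n + 1) → ℤ) (rotatePerm n) =
      (n + e * ∑ i, d i).negOnePow := by
  rw [rotatePerm, altSign_insertPerm, ← insertSign_last]
  simp [altSign_eq_prod]
  refine Finset.prod_eq_one fun i _ => Finset.prod_eq_one fun j _ => if_neg fun h => ?_
  exact absurd h.1 h.2.not_gt

theorem rotatePerm_castSucc {n : ℕ} (i : Fin n) : rotatePerm n i.castSucc = i.succ := by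
  rw [rotatePerm, ← Fin.succAbove_last_apply, insertPerm_succAbove]
  rfl

theorem rotatePerm_last {n : ℕ} : rotatePerm n (Fin.last n) = 0 := insertPerm_self _ _

/-! ### Hochschild coboundaries under alternation -/

section Cochains

variable {k : Type*} [Field k] {A : Type*} [Ring A] [Algebra k A] (𝒜 : ℤ → Submodule k A)

/-- Homogeneous elements, together with their degree. -/
abbrev Homogeneous : Type _ := Σ j : ℤ, 𝒜 j

namespace Homogeneous

variable {𝒜}

/-- The degree. -/
def deg (x : Homogeneous 𝒜) : ℤ := x.1

/-- The underlying element. -/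
def val (x : Homogeneous 𝒜) : A := x.2

theorem val_mem (x : Homogeneous 𝒜) : x.val ∈ 𝒜 x.deg := x.2.2

/-- The product. -/
def mul (h : IsGradedCommutative 𝒜) (x y : Homogeneous 𝒜) : Homogeneous 𝒜 :=
  ⟨x.deg + y.deg, x.val * y.val, h.mul_mem _ _ _ x.val_mem _ y.val_mem⟩

theorem val_mul (h : IsGradedCommutative 𝒜) (x y : Homogeneous 𝒜) :
    (mul h x y).val = x.val * y.val := rfl

theorem deg_mul (h : IsGradedCommutative 𝒜) (x y : Homogeneous 𝒜) :
    (mul h x y).deg = x.deg + y.deg := rfl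

theorem mul_comm (h : IsGradedCommutative 𝒜) (x y : Homogeneous 𝒜) :
    x.val * y.val = (x.deg * y.deg).negOnePow • (y.val * x.val) :=
  h.mul_comm _ _ _ x.val_mem _ y.val_mem

end Homogeneous

/-- The word obtained by multiplying the letters at the positions `j` and `j + 1`. -/
def mergeWord {n : ℕ} (j : Fin n) (w : Fin (n + 1) → A) : Fin n → A := fun i =>
  if i < j then w i.castSucc else if i = j then w i.castSucc * w i.succ else w i.succ

theorem mergeWord_eq_update {n : ℕ} (j : Fin n) (w : Fin (n + 1) → A) :
    mergeWord j w = Function.update (mergeWord j w) j (w j.castSucc * w j.succ) := by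
  rw [eq_comm, Function.update_eq_self_iff]
  simp [mergeWord]

theorem mergeWord_insertNth {n : ℕ} (j : Fin (n + 1)) (b c : A) (w : Fin n → A) :
    mergeWord j (j.castSucc.insertNth b (j.insertNth c w : Fin (n + 1) → A) : Fin (n + 2) → A) =
      j.insertNth (b * c) w := by
  refine Fin.eq_insertNth_iff.2 ⟨?_, ?_⟩
  · rw [mergeWord, if_neg (lt_irrefl _), if_pos rfl, Fin.insertNth_apply_same,
      ← Fin.succAbove_castSucc_self, Fin.insertNth_apply_succAbove, Fin.insertNth_apply_same]
  · funext i
    rw [Fin.removeNth, mergeWord]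
    by_cases h : i.castSucc < j
    · have h1 : j.succAbove i = i.castSucc := Fin.succAbove_of_castSucc_lt _ _ h
      rw [if_pos (by rwa [h1])]
      have h2 : (j.succAbove i).castSucc = j.castSucc.succAbove (j.succAbove i) := by
        rw [Fin.succAbove_of_castSucc_lt j.castSucc]
        rw [h1]; exact h
      rw [h2, Fin.insertNth_apply_succAbove, Fin.insertNth_apply_succAbove]
    · have h1 : j.succAbove i = i.succ := Fin.succAbove_of_le_castSucc _ _ (not_lt.1 h)
      have h3 : j < j.succAbove i := by
        rw [h1]; exact lt_of_le_of_lt (not_lt.1 h) (Fin.castSucc_lt_succ)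
      rw [if_neg h3.not_gt, if_neg h3.ne']
      have h2 : (j.succAbove i).succ = j.castSucc.succAbove (j.succAbove i) := by
        rw [Fin.succAbove_of_le_castSucc j.castSucc]
        exact h3.le
      rw [h2, Fin.insertNth_apply_succAbove, Fin.insertNth_apply_succAbove]

variable {𝒜}

open Homogeneous in
/-- The Hochschild coboundary of a cochain of degree `2 - n`, up to sign. -/
def hochschildCoboundary {n : ℕ} (f : MultilinearMap k (fun _ : Fin n => A) A)
    (x : Fin (n + 1) → Homogeneous 𝒜) : A :=
  (n : ℤ).negOnePow • (f (val ∘ Fin.init x) * (x (Fin.last n)).val)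
    - (n * (x 0).deg).negOnePow • ((x 0).val * f (val ∘ Fin.tail x))
    + ∑ j : Fin n, (j : ℤ).negOnePow • f (mergeWord j (val ∘ x))

/-- `f` has degree `2 - n`. -/
def HasCochainDegree (𝒜 : ℤ → Submodule k A) {n : ℕ}
    (f : MultilinearMap k (fun _ : Fin n => A) A) : Prop :=
  ∀ x : Fin n → Homogeneous 𝒜, f (Homogeneous.val ∘ x) ∈ 𝒜 (∑ i, (x i).deg + 2 - n)

open Homogeneous

/-- The exchange contributes -(-1)^(|a||b|), and graded commutativity of the merged product
contributes (-1)^(|a||b|). -/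
theorem signedReindex_swap_mergeWord (h : IsGradedCommutative 𝒜) {n : ℕ}
    (f : MultilinearMap k (fun _ : Fin n => A) A) (j : Fin n) (x : Fin (n + 1) → Homogeneous 𝒜) :
    signedReindex deg (Equiv.swap j.castSucc j.succ) (fun y => f (mergeWord j (val ∘ y))) x =
      -f (mergeWord j (val ∘ x)) := by
  rw [signedReindex, altSign_swap_adjacent, mergeWord_eq_update]
  have h1 : Function.update (mergeWord j (val ∘ x ∘ Equiv.swap j.castSucc j.succ)) j
      ((val ∘ x ∘ Equiv.swap j.castSucc j.succ) j.castSucc *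
        (val ∘ x ∘ Equiv.swap j.castSucc j.succ) j.succ) =
      Function.update (mergeWord j (val ∘ x)) j
        (((x j.castSucc).deg * (x j.succ).deg).negOnePow •
          ((val ∘ x) j.castSucc * (val ∘ x) j.succ)) := by
    funext i
    by_cases hi : i = j
    · subst hi
      simp only [Function.update_self, Function.comp_apply, Equiv.swap_apply_left,
        Equiv.swap_apply_right]
      rw [Homogeneous.mul_comm h, _root_.mul_comm (deg _)]
    · have hi' : (i : ℕ) ≠ j := fun h => hi (Fin.ext h)
      rw [Function.update_of_ne hi, Function.update_of_ne hi, mergeWord, mergeWord]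
      simp only [Function.comp_apply, hi, if_false]
      split_ifs with h2
      · rw [Equiv.swap_apply_of_ne_of_ne]
        · simp [hi]
        · rw [Ne, Fin.ext_iff]; simp only [Fin.val_castSucc, Fin.val_succ]
          rw [Fin.lt_def] at h2; omega
      · rw [Equiv.swap_apply_of_ne_of_ne]
        · rw [Ne, Fin.ext_iff]; simp only [Fin.val_castSucc, Fin.val_succ]
          rw [Fin.lt_def] at h2; omega
        · simp [hi]
  rw [h1, multilinear_update_units_smul, ← mergeWord_eq_update, smul_smul, exchangeSign]
  simp [Units.neg_smul]

/-- Rotation brings the first letter to the end, and graded commutativity moves it back in front of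
the value of f. The degree 2 - n of f is what makes the signs agree. -/
theorem signedReindex_rotatePerm (h : IsGradedCommutative 𝒜) {n : ℕ}
    (f : MultilinearMap k (fun _ : Fin n => A) A) (hf : HasCochainDegree 𝒜 f)
    (x : Fin (n + 1) → Homogeneous 𝒜) :
    signedReindex deg (rotatePerm n)
      (fun x => (n : ℤ).negOnePow • (f (val ∘ Fin.init x) * (x (Fin.last n)).val)) x =
      (n * (x 0).deg).negOnePow • ((x 0).val * f (val ∘ Fin.tail x)) := by
  rw [← Fin.cons_self_tail x]
  generalize Fin.tail x = w
  generalize x 0 = y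
  rw [signedReindex, comp_cons, altSign_rotatePerm, cons_comp_rotatePerm]
  simp only [Fin.init_snoc, Fin.snoc_last, Fin.cons_zero, Fin.tail_cons]
  rw [h.mul_comm _ _ _ (hf w) _ y.val_mem, smul_smul, smul_smul, ← Int.negOnePow_add,
    ← Int.negOnePow_add]
  congr 1
  refine negOnePow_eq_of_sub_eq (n + y.deg * ∑ i, (w i).deg + y.deg - n * y.deg) ?_
  simp only [Function.comp_apply]
  ring

/-- The outer terms cancel each other by rotation, and each merging term cancels itself by an
adjacent swap. -/
theorem alternation_hochschildCoboundary [CharZero k] (h : IsGradedCommutative 𝒜) {n : ℕ}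
    (f : MultilinearMap k (fun _ : Fin n => A) A) (hf : HasCochainDegree 𝒜 f)
    (x : Fin (n + 1) → Homogeneous 𝒜) :
    alternation deg (hochschildCoboundary f) x = 0 := by
  have : IsAddTorsionFree A := .of_isTorsionFree k A
  have h1 := alternation_signedReindex deg (rotatePerm n) (fun x : Fin (n + 1) → Homogeneous 𝒜 =>
    (n : ℤ).negOnePow • (f (val ∘ Fin.init x) * (x (Fin.last n)).val)) x
  rw [show signedReindex deg (rotatePerm n) _ = _ from
    funext fun x => signedReindex_rotatePerm h f hf x] at h1
  unfold hochschildCoboundary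
  simp only [sub_eq_add_neg]
  rw [alternation_add, alternation_add, alternation_neg, h1, add_neg_cancel, zero_add,
    alternation_sum]
  refine Finset.sum_eq_zero fun j _ => ?_
  rw [alternation_smul, alternation_eq_zero_of_signedReindex_eq_neg deg
    (Equiv.swap j.castSucc j.succ) _ (signedReindex_swap_mergeWord h f j), smul_zero]

end Cochains

/-! ### Alternated Hochschild cocycles are derivations -/

section Derivation

variable {k : Type*} [Field k] {A : Type*} [Ring A] [Algebra k A] {𝒜 : ℤ → Submodule k A}

open Homogeneous

/-- The alternation of a cochain, on homogeneous elements. -/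
def alternate {n : ℕ} (f : MultilinearMap k (fun _ : Fin n => A) A)
    (x : Fin n → Homogeneous 𝒜) : A :=
  alternation deg (fun y => f (val ∘ y)) x

theorem alternate_cons_eq_snoc {n : ℕ} (f : MultilinearMap k (fun _ : Fin (n + 1) => A) A)
    (y : Homogeneous 𝒜) (a : Fin n → Homogeneous 𝒜) :
    alternate f (Fin.cons y a : Fin (n + 1) → Homogeneous 𝒜) =
      (n + y.deg * ∑ i, (a i).deg).negOnePow •
        alternate f (Fin.snoc a y : Fin (n + 1) → Homogeneous 𝒜) := by
  rw [alternate, ← alternation_comp_perm deg (rotatePerm n), comp_cons, altSign_rotatePerm,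
    cons_comp_rotatePerm]
  rfl

theorem alternate_mem {n : ℕ} (f : MultilinearMap k (fun _ : Fin n => A) A)
    (hf : HasCochainDegree 𝒜 f) (x : Fin n → Homogeneous 𝒜) :
    alternate f x ∈ 𝒜 (∑ i, (x i).deg + 2 - n) := by
  refine Submodule.sum_mem _ fun σ _ => ?_
  have := hf (x ∘ σ)
  simp only [Function.comp_apply] at this
  rw [Equiv.sum_comp σ fun i => (x i).deg] at this
  rcases Int.units_eq_one_or (altSign (deg ∘ x) σ) with h | h <;> rw [h]
  · rw [one_smul]
    exact this
  · rw [Units.neg_smul, one_smul]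
    exact Submodule.neg_mem _ this

theorem sum_perm_first_term {n : ℕ} (f : MultilinearMap k (fun _ : Fin n => A) A)
    (y : Homogeneous 𝒜) (w : Fin n → Homogeneous 𝒜) :
    (∑ σ : Equiv.Perm (Fin (n + 1)), if σ 0 = 0 then
      altSign (deg ∘ (Fin.cons y w : Fin (n + 1) → Homogeneous 𝒜)) σ •
        (fun x : Fin (n + 1) → Homogeneous 𝒜 =>
          (n * (x 0).deg).negOnePow • ((x 0).val * f (val ∘ Fin.tail x)))
        ((Fin.cons y w : Fin (n + 1) → Homogeneous 𝒜) ∘ σ) else 0) =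
    (n * y.deg).negOnePow • (y.val * alternate f w) := by
  rw [sum_perm_apply_eq_zero, alternate, alternation, Finset.mul_sum, Finset.smul_sum]
  refine Finset.sum_congr rfl fun τ _ => ?_
  rw [comp_cons, altSign_insertPerm, cons_comp_insertPerm, insertSign_zero, mul_one,
    Fin.insertNth_zero']
  simp only [Fin.cons_zero, Fin.tail_cons]
  rw [smul_comm, mul_units_smul]

theorem comp_insertNth {P Q : Type*} (g : P → Q) {n : ℕ} (j : Fin (n + 1)) (y : P)
    (w : Fin n → P) : g ∘ (j.insertNth y w : Fin (n + 1) → P) = j.insertNth (g y) (g ∘ w) := by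
  rw [Fin.eq_insertNth_iff]
  refine ⟨by simp, ?_⟩
  funext i
  simp [Fin.removeNth]

/-- Inserting c at position j and then b just before it runs through all words containing bc as a
block at j. After merging, these are the words with the single letter bc inserted at j, with
matching sign by `insertSign_mul`. -/
theorem sum_perm_merge_term (h : IsGradedCommutative 𝒜) {n : ℕ}
    (f : MultilinearMap k (fun _ : Fin (n + 1) => A) A)
    (b c : Homogeneous 𝒜) (a : Fin n → Homogeneous 𝒜) :
    (∑ j : Fin (n + 1), (j : ℤ).negOnePow • ∑ σ : Equiv.Perm (Fin (n + 2)),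
      if σ j.castSucc = 0 ∧ σ j.succ = 1 then
        altSign (deg ∘ (Fin.cons b (Fin.cons c a : Fin (n + 1) → Homogeneous 𝒜) :
          Fin (n + 2) → Homogeneous 𝒜)) σ •
        f (mergeWord j (val ∘ ((Fin.cons b (Fin.cons c a : Fin (n + 1) → Homogeneous 𝒜) :
          Fin (n + 2) → Homogeneous 𝒜) ∘ σ))) else 0) =
    alternate f (Fin.cons (mul h b c) a : Fin (n + 1) → Homogeneous 𝒜) := by
  rw [alternate, alternation_cons, alternation_sum]
  refine Finset.sum_congr rfl fun j _ => ?_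
  simp only [ite_and]
  rw [sum_perm_apply_eq_zero, ← Fin.succAbove_castSucc_self]
  simp only [insertPerm_succAbove]
  have h01 : ∀ i : Fin (n + 1), i.succ = (1 : Fin (n + 2)) ↔ i = 0 := fun i => by
    rw [← Fin.succ_zero_eq_one, Fin.succ_inj]
  simp only [h01]
  rw [sum_perm_apply_eq_zero, alternation, Finset.smul_sum]
  refine Finset.sum_congr rfl fun π _ => ?_
  rw [comp_cons, altSign_insertPerm, cons_comp_insertPerm, comp_cons, altSign_insertPerm,
    cons_comp_insertPerm, cons_comp_insertPerm, insertSign_castSucc]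
  rw [comp_insertNth, comp_insertNth, mergeWord_insertNth]
  rw [smul_smul, smul_smul, mul_assoc, insertSign_mul, deg_mul, comp_insertNth, val_mul,
    add_comm c.deg, mul_left_comm, ← mul_assoc (j : ℤ).negOnePow, Int.units_mul_self, one_mul]
  rfl

theorem cons_cons_comp_swap {P : Type*} {n : ℕ} (b c : P) (a : Fin n → P) :
    (Fin.cons b (Fin.cons c a : Fin (n + 1) → P) : Fin (n + 2) → P) ∘ Equiv.swap 0 1 =
      Fin.cons c (Fin.cons b a : Fin (n + 1) → P) := by
  funext i
  refine Fin.cases ?_ (fun i => Fin.cases ?_ (fun i => ?_) i) i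
  · rw [Function.comp_apply, Equiv.swap_apply_left]
    rfl
  · rw [Function.comp_apply, Fin.succ_zero_eq_one, Equiv.swap_apply_right]
    rfl
  · rw [Function.comp_apply, Equiv.swap_apply_of_ne_of_ne (Fin.succ_ne_zero _)]
    · rfl
    · exact fun h => Fin.succ_ne_zero _ (Fin.succ_injective _ h)

theorem altSign_swap_zero_one {n : ℕ} (d : Fin (n + 2) → ℤ) :
    altSign d (Equiv.swap 0 1) = exchangeSign (d 0) (d 1) :=
  altSign_swap_adjacent d 0

/-- The Leibniz rule in the first argument, obtained by summing the cocycle condition over half of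
the words in b, c and a. -/
theorem alternate_mul_cons (h : IsGradedCommutative 𝒜) [CharZero k] {n : ℕ}
    (f : MultilinearMap k (fun _ : Fin (n + 1) => A) A) (hf : HasCochainDegree 𝒜 f)
    (hδ : ∀ x : Fin (n + 2) → Homogeneous 𝒜, hochschildCoboundary f x = 0)
    (b c : Homogeneous 𝒜) (a : Fin n → Homogeneous 𝒜) :
    exchangeSign b.deg c.deg • ((n + 1 : ℕ) * c.deg).negOnePow •
        (c.val * alternate f (Fin.cons b a : Fin (n + 1) → Homogeneous 𝒜)) -
      ((n + 1 : ℕ) * b.deg).negOnePow •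
        (b.val * alternate f (Fin.cons c a : Fin (n + 1) → Homogeneous 𝒜)) +
      alternate f (Fin.cons (mul h b c) a : Fin (n + 1) → Homogeneous 𝒜) = 0 := by
  set x : Fin (n + 2) → Homogeneous 𝒜 :=
    Fin.cons b (Fin.cons c a : Fin (n + 1) → Homogeneous 𝒜) with hx
  -- The letter b has index 0 and c has index 1, and `σ.symm` gives their positions in the word.
  let isBefore : Equiv.Perm (Fin (n + 2)) → Prop := fun σ => σ.symm 0 < σ.symm 1
  let T : (Fin (n + 2) → Homogeneous 𝒜) → A := fun x =>
    ((n + 1 : ℕ) : ℤ).negOnePow • (f (val ∘ Fin.init x) * (x (Fin.last (n + 1))).val)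
  let S : (Fin (n + 2) → Homogeneous 𝒜) → A := fun x =>
    ((n + 1 : ℕ) * (x 0).deg).negOnePow • ((x 0).val * f (val ∘ Fin.tail x))
  let C : Fin (n + 1) → (Fin (n + 2) → Homogeneous 𝒜) → A := fun j x => f (mergeWord j (val ∘ x))
  have total : ∀ σ : Equiv.Perm (Fin (n + 2)), altSign (deg ∘ x) σ • T (x ∘ σ) -
      altSign (deg ∘ x) σ • S (x ∘ σ) +
      ∑ j : Fin (n + 1), (j : ℤ).negOnePow • altSign (deg ∘ x) σ • C j (x ∘ σ) = 0 := by
    intro σ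
    have := hδ (x ∘ σ)
    rw [hochschildCoboundary] at this
    have h2 := congrArg (fun z => altSign (deg ∘ x) σ • z) this
    simp only [smul_add, smul_sub, smul_zero, Finset.smul_sum] at h2
    rw [← h2]
    congr 1
    exact Finset.sum_congr rfl fun j _ => smul_comm _ _ _
  have hne : ∀ σ : Equiv.Perm (Fin (n + 2)), σ.symm 0 ≠ σ.symm 1 := fun σ hσ => by
    simpa using σ.symm.injective hσ
  have split : ∀ (p q : Equiv.Perm (Fin (n + 2)) → Prop) [DecidablePred p] [DecidablePred q]
      (G : Equiv.Perm (Fin (n + 2)) → A), (∑ σ, if p σ then G σ else 0) =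
      (∑ σ, if p σ ∧ q σ then G σ else 0) + ∑ σ, if p σ ∧ ¬ q σ then G σ else 0 := by
    intro p q _ _ G
    rw [← Finset.sum_add_distrib]
    refine Finset.sum_congr rfl fun σ _ => ?_
    by_cases hp : p σ <;> by_cases hq : q σ <;> simp [hp, hq]
  have : IsAddTorsionFree A := .of_isTorsionFree k A
  -- Swapping the positions j and j + 1 preserves the order of b and c unless these two letters
  -- occupy them. All other merging terms therefore cancel in pairs.
  have merge : ∀ j : Fin (n + 1),
      (∑ σ, if isBefore σ then altSign (deg ∘ x) σ • C j (x ∘ σ) else 0) =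
      ∑ σ, if σ j.castSucc = 0 ∧ σ j.succ = 1 then altSign (deg ∘ x) σ • C j (x ∘ σ) else 0 := by
    intro j
    rw [split isBefore (fun σ => σ j.castSucc = 0 ∧ σ j.succ = 1)]
    have hz : (∑ σ, if isBefore σ ∧ ¬ (σ j.castSucc = 0 ∧ σ j.succ = 1) then
        altSign (deg ∘ x) σ • C j (x ∘ σ) else 0) = 0 := by
      rw [← self_eq_neg, ← Finset.sum_neg_distrib]
      refine (Equiv.sum_comp (Equiv.mulRight (Equiv.swap j.castSucc j.succ)) _).symm.trans
        (Finset.sum_congr rfl fun σ _ => ?_)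
      rw [Equiv.coe_mulRight, signed_term_mul,
        signedReindex_swap_mergeWord h f j, smul_neg]
      refine (if_congr ?_ rfl neg_zero.symm).trans (apply_ite Neg.neg _ _ _).symm
      have hu : (σ * Equiv.swap j.castSucc j.succ).symm =
        σ.symm.trans (Equiv.swap j.castSucc j.succ) := rfl
      have huv := hne σ
      simp only [isBefore, hu, Equiv.trans_apply, Equiv.Perm.mul_apply, Equiv.swap_apply_left,
        Equiv.swap_apply_right, ← Equiv.eq_symm_apply]
      generalize σ.symm 0 = u at *
      generalize σ.symm 1 = v at *
      simp only [Equiv.swap_apply_def, Fin.lt_def, Fin.ext_iff, ne_eq] at *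
      split_ifs <;> simp only [Fin.val_castSucc, Fin.val_succ] at * <;> omega
    rw [hz, add_zero]
    refine Finset.sum_congr rfl fun σ _ => if_congr ?_ rfl rfl
    refine ⟨fun h => h.2, fun h => ⟨?_, h⟩⟩
    simp only [isBefore]
    rw [Equiv.symm_apply_eq _ |>.2 h.1.symm, Equiv.symm_apply_eq _ |>.2 h.2.symm]
    exact Fin.castSucc_lt_succ
  -- Moving the first letter to the end preserves the order of b and c unless that letter is b or c.
  -- As b comes before c, the exceptions are the words starting with b, and on the other side those
  -- ending with c.
  have rotate : (∑ σ, if isBefore σ ∧ σ (Fin.last _) ≠ 1 then altSign (deg ∘ x) σ • T (x ∘ σ) else 0) =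
      ∑ σ, if isBefore σ ∧ σ 0 ≠ 0 then altSign (deg ∘ x) σ • S (x ∘ σ) else 0 := by
    refine (Equiv.sum_comp (Equiv.mulRight (rotatePerm (n + 1))) _).symm.trans
      (Finset.sum_congr rfl fun σ _ => ?_)
    rw [Equiv.coe_mulRight, signed_term_mul, signedReindex_rotatePerm h f hf]
    refine if_congr ?_ rfl rfl
    have huv := hne σ
    rw [Equiv.Perm.mul_apply, rotatePerm_last, ne_eq, ne_eq, ← Equiv.eq_symm_apply,
      ← Equiv.eq_symm_apply]
    have hu : ∀ i, (σ * rotatePerm (n + 1)).symm i = (rotatePerm (n + 1)).symm (σ.symm i) :=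
      fun _ => rfl
    simp only [isBefore, hu]
    obtain ⟨u, hu⟩ := (rotatePerm (n + 1)).surjective (σ.symm 0)
    obtain ⟨v, hv⟩ := (rotatePerm (n + 1)).surjective (σ.symm 1)
    rw [← hu, ← hv, Equiv.symm_apply_apply, Equiv.symm_apply_apply]
    rw [← hu, ← hv] at huv
    clear hu hv
    refine Fin.lastCases ?_ (fun u => ?_) u <;> refine Fin.lastCases ?_ (fun v => ?_) v
    all_goals simp [rotatePerm_last, rotatePerm_castSucc, Fin.castSucc_lt_last,
      (Fin.succ_ne_zero _).symm, (Fin.castSucc_lt_last _).le]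
  have first : (∑ σ, if isBefore σ ∧ σ 0 = 0 then altSign (deg ∘ x) σ • S (x ∘ σ) else 0) =
      ((n + 1 : ℕ) * b.deg).negOnePow •
        (b.val * alternate f (Fin.cons c a : Fin (n + 1) → Homogeneous 𝒜)) := by
    rw [← sum_perm_first_term]
    refine Finset.sum_congr rfl fun σ _ => if_congr ⟨fun h => h.2, fun h => ⟨?_, h⟩⟩ rfl rfl
    have h0 : σ.symm 0 = 0 := (Equiv.symm_apply_eq _).2 h.symm
    have := hne σ
    simp only [isBefore]
    rw [h0] at this ⊢
    exact Fin.pos_of_ne_zero this.symm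
  have last : (∑ σ, if isBefore σ ∧ σ (Fin.last _) = 1 then altSign (deg ∘ x) σ • T (x ∘ σ) else 0) =
      exchangeSign b.deg c.deg • ((n + 1 : ℕ) * c.deg).negOnePow •
        (c.val * alternate f (Fin.cons b a : Fin (n + 1) → Homogeneous 𝒜)) := by
    rw [← sum_perm_first_term, Finset.smul_sum]
    -- The rotation turns words ending with c into words starting with c; the swap of 0 and 1 makes
    -- c the first letter, as `sum_perm_first_term` requires.
    refine (Equiv.sum_comp ((Equiv.mulRight (rotatePerm (n + 1))).trans
      (Equiv.mulLeft (Equiv.swap 0 1))) _).symm.trans (Finset.sum_congr rfl fun σ _ => ?_)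
    simp only [Equiv.trans_apply, Equiv.coe_mulRight, Equiv.coe_mulLeft]
    have h3 : altSign (deg ∘ x) (Equiv.swap 0 1 * (σ * rotatePerm (n + 1))) •
        T (x ∘ (Equiv.swap 0 1 * (σ * rotatePerm (n + 1)) : Equiv.Perm (Fin (n + 2)))) = exchangeSign b.deg c.deg •
        altSign (deg ∘ (Fin.cons c (Fin.cons b a : Fin (n + 1) → Homogeneous 𝒜) :
          Fin (n + 2) → Homogeneous 𝒜)) σ •
        S ((Fin.cons c (Fin.cons b a : Fin (n + 1) → Homogeneous 𝒜) :
          Fin (n + 2) → Homogeneous 𝒜) ∘ σ) := by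
      have h4 := signed_term_mul deg T (x ∘ Equiv.swap 0 1) σ (rotatePerm (n + 1))
      rw [signedReindex_rotatePerm h f hf, hx, cons_cons_comp_swap] at h4
      rw [altSign_mul, altSign_swap_zero_one, mul_smul]
      refine congrArg (exchangeSign b.deg c.deg • ·) (Eq.trans ?_ h4)
      rw [← cons_cons_comp_swap b c a]
      rfl
    rw [h3]
    refine (if_congr ?_ rfl (smul_zero _).symm).trans (apply_ite _ _ _ _).symm
    have h5 : (Equiv.swap 0 1 * (σ * rotatePerm (n + 1)) : Equiv.Perm (Fin (n + 2)))
        (Fin.last (n + 1)) = 1 ↔ σ 0 = 0 := by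
      rw [Equiv.Perm.mul_apply, Equiv.Perm.mul_apply, rotatePerm_last]
      refine ⟨fun h => (Equiv.swap (0 : Fin (n + 2)) 1).injective ?_, fun h => ?_⟩
      · rw [h, Equiv.swap_apply_left]
      · rw [h, Equiv.swap_apply_left]
    rw [h5]
    refine ⟨fun h => h.2, fun h => ⟨?_, h⟩⟩
    have h6 := (Equiv.symm_apply_eq _).2 (h5.2 h).symm
    have h7 := hne (Equiv.swap 0 1 * (σ * rotatePerm (n + 1)))
    simp only [isBefore]
    rw [h6] at h7 ⊢
    exact Fin.lt_last_iff_ne_last.2 h7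
  have key : (∑ σ, if isBefore σ then altSign (deg ∘ x) σ • T (x ∘ σ) else 0) -
      (∑ σ, if isBefore σ then altSign (deg ∘ x) σ • S (x ∘ σ) else 0) +
      ∑ j : Fin (n + 1), (j : ℤ).negOnePow •
        (∑ σ, if isBefore σ then altSign (deg ∘ x) σ • C j (x ∘ σ) else 0) = 0 := by
    simp only [Finset.smul_sum]
    rw [Finset.sum_comm, ← Finset.sum_sub_distrib, ← Finset.sum_add_distrib]
    refine Finset.sum_eq_zero fun σ _ => ?_
    by_cases hσ : isBefore σ
    · simpa only [hσ, if_true] using total σ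
    · simp [hσ]
  simp only [merge] at key
  rw [split isBefore (fun σ => σ (Fin.last _) = 1), split isBefore (fun σ => σ 0 = 0), first, last, rotate,
    sum_perm_merge_term h f b c a, add_sub_add_right_eq_sub] at key
  exact key

theorem alternate_snoc_mul (h : IsGradedCommutative 𝒜) [CharZero k] {n : ℕ}
    (f : MultilinearMap k (fun _ : Fin (n + 1) => A) A) (hf : HasCochainDegree 𝒜 f)
    (hδ : ∀ x : Fin (n + 2) → Homogeneous 𝒜, hochschildCoboundary f x = 0)
    (b c : Homogeneous 𝒜) (a : Fin n → Homogeneous 𝒜) :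
    alternate f (Fin.snoc a (mul h b c) : Fin (n + 1) → Homogeneous 𝒜) =
      alternate f (Fin.snoc a b : Fin (n + 1) → Homogeneous 𝒜) * c.val +
      ((2 - (n + 1 : ℕ) + ∑ i, (a i).deg) * b.deg).negOnePow •
        (b.val * alternate f (Fin.snoc a c : Fin (n + 1) → Homogeneous 𝒜)) := by
  have key := alternate_mul_cons h f hf hδ b c a
  have hb := alternate_mem f hf (Fin.cons b a : Fin (n + 1) → Homogeneous 𝒜)
  rw [h.mul_comm _ _ _ c.val_mem _ hb, alternate_cons_eq_snoc, alternate_cons_eq_snoc,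
    alternate_cons_eq_snoc, units_smul_mul, mul_units_smul, deg_mul, exchangeSign_eq] at key
  simp only [smul_smul, ← Int.negOnePow_add] at key
  simp only [Fin.sum_univ_succ, Fin.cons_zero, Fin.cons_succ] at key
  set D := ∑ i, (a i).deg
  -- All three signs share the factor (-1)^(n + (|b| + |c|) D). Beyond it there remain -1, the
  -- Leibniz sign of b, and 1.
  rw [negOnePow_eq_of_sub_eq (b := n + (b.deg + c.deg) * D + 1) (b.deg * c.deg + c.deg) (by ring),
    negOnePow_eq_of_sub_eq (a := (n + 1 : ℕ) * b.deg + (n + c.deg * D))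
      (b := n + (b.deg + c.deg) * D + (2 - (n + 1 : ℕ) + D) * b.deg)
      ((n + 1 : ℕ) * b.deg - b.deg * D - b.deg) (by ring),
    Int.negOnePow_succ, Units.neg_smul, Int.negOnePow_add _ ((2 - (n + 1 : ℕ) + D) * b.deg),
    mul_smul, ← smul_neg, ← smul_sub, ← smul_add] at key
  have key' := (smul_eq_zero_iff_eq _).1 key
  rw [← sub_eq_zero, ← key']
  abel

end Derivation

/-! ### Block permutations and nested alternations -/

section BlockPermutations

variable {q r : ℕ}

/-- The permutation acting by `ρ` on the first `q` letters and by `τ` on the others. -/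
def blockPerm (ρ : Equiv.Perm (Fin q)) (τ : Equiv.Perm (Fin r)) : Equiv.Perm (Fin (q + r)) :=
  finSumFinEquiv.permCongr (Equiv.Perm.sumCongr ρ τ)

theorem blockPerm_castAdd (ρ : Equiv.Perm (Fin q)) (τ : Equiv.Perm (Fin r)) (i : Fin q) :
    blockPerm ρ τ (Fin.castAdd r i) = Fin.castAdd r (ρ i) := by
  simp [blockPerm]

theorem blockPerm_natAdd (ρ : Equiv.Perm (Fin q)) (τ : Equiv.Perm (Fin r)) (i : Fin r) :
    blockPerm ρ τ (Fin.natAdd q i) = Fin.natAdd q (τ i) := by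
  simp [blockPerm]

theorem castAdd_lt_natAdd' (i : Fin q) (j : Fin r) : Fin.castAdd r i < Fin.natAdd q j := by
  rw [Fin.lt_def, Fin.val_castAdd, Fin.val_natAdd]
  omega

theorem altSign_blockPerm (d : Fin (q + r) → ℤ) (ρ : Equiv.Perm (Fin q))
    (τ : Equiv.Perm (Fin r)) :
    altSign d (blockPerm ρ τ) = altSign (d ∘ Fin.castAdd r) ρ * altSign (d ∘ Fin.natAdd q) τ := by
  rw [altSign_eq_prod, altSign_eq_prod, altSign_eq_prod, Fin.prod_univ_add]
  congr 1
  · refine Finset.prod_congr rfl fun i _ => ?_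
    rw [Fin.prod_univ_add, Finset.prod_congr rfl fun j _ => ?_,
      Finset.prod_eq_one (s := Finset.univ (α := Fin r)) fun j _ => ?_, mul_one]
    · rw [blockPerm_castAdd, blockPerm_natAdd, if_neg fun h => ?_]
      exact (castAdd_lt_natAdd' _ _).not_gt h.2
    · rw [blockPerm_castAdd, blockPerm_castAdd]
      rfl
  · refine Finset.prod_congr rfl fun i _ => ?_
    rw [Fin.prod_univ_add, Finset.prod_eq_one (s := Finset.univ (α := Fin q)) fun j _ => ?_,
      Finset.prod_congr rfl fun j _ => ?_, one_mul]
    · rw [blockPerm_natAdd, blockPerm_natAdd]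
      simp
    · rw [if_neg fun h => ?_]
      exact (castAdd_lt_natAdd' _ _).not_gt h.1

/-- The permutation moving the first `q` letters past the next `j` letters. -/
def blockMove (q : ℕ) {r : ℕ} (j : Fin (r + 1)) : Equiv.Perm (Fin (q + r)) where
  toFun i := ⟨if (i : ℕ) < j then q + i else if (i : ℕ) < j + q then i - j else i, by
    have := j.2
    have := i.2
    split_ifs <;> omega⟩
  invFun i := ⟨if (i : ℕ) < q then i + j else if (i : ℕ) < q + j then i - q else i, by
    have := j.2
    have := i.2
    split_ifs <;> omega⟩
  left_inv i := by
    ext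
    dsimp only
    split_ifs <;> omega
  right_inv i := by
    ext
    dsimp only
    split_ifs <;> omega

theorem blockMove_symm_val (j : Fin (r + 1)) (i : Fin (q + r)) :
    ((blockMove q j).symm i : ℕ) =
      if (i : ℕ) < q then (i : ℕ) + j else if (i : ℕ) < q + j then (i : ℕ) - q else i := rfl

/-- The inverted pairs consist of one of the first q letters and one of the j letters they pass. -/
theorem altSign_blockMove (d : Fin (q + r) → ℤ) (j : Fin (r + 1)) :
    altSign d (blockMove q j) = ∏ i : Fin r, if i.castSucc < j then
      (q + d (Fin.natAdd q i) * ∑ l, d (Fin.castAdd r l)).negOnePow else 1 := by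
  -- Both products are reindexed from positions to letters, where the inverted pairs are easy to
  -- describe.
  have h1 : altSign d (blockMove q j) = ∏ a, ∏ b, if (blockMove q j).symm a <
      (blockMove q j).symm b ∧ b < a then exchangeSign (d a) (d b) else 1 := by
    rw [altSign_eq_prod]
    refine Eq.trans ?_ (Equiv.prod_comp (blockMove q j) _)
    refine Finset.prod_congr rfl fun a _ => ?_
    refine Eq.trans ?_ (Equiv.prod_comp (blockMove q j) _)
    simp
  have h2 : ∀ a b : Fin (q + r), ((blockMove q j).symm a < (blockMove q j).symm b ∧ b < a) ↔
      ((b : ℕ) < q ∧ q ≤ (a : ℕ) ∧ (a : ℕ) < q + j) := by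
    intro a b
    rw [Fin.lt_def, Fin.lt_def, blockMove_symm_val, blockMove_symm_val]
    have := j.2
    split_ifs <;> omega
  simp only [h1, h2]
  rw [Fin.prod_univ_add, Finset.prod_eq_one, one_mul]
  · refine Finset.prod_congr rfl fun i _ => ?_
    rw [Fin.prod_univ_add, Finset.prod_eq_one (s := Finset.univ (α := Fin r)), mul_one]
    · have : i.castSucc < j ↔ (i : ℕ) < j := by rw [Fin.lt_def, Fin.val_castSucc]
      simp only [Fin.val_castAdd, Fin.is_lt, Fin.val_natAdd, true_and, Nat.le_add_right,
        Nat.add_lt_add_iff_left, this]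
      split_ifs
      · rw [← prod_exchangeSign]
        exact Finset.prod_congr rfl fun l _ => exchangeSign_comm _ _
      · simp
    · intro l _
      rw [if_neg]
      rw [Fin.val_natAdd]
      omega
  · intro i _
    refine Finset.prod_eq_one fun b _ => if_neg ?_
    rw [Fin.val_castAdd]
    omega

end BlockPermutations

section AlternationBlocks

variable {P W : Type*} [AddCommGroup W] (deg : P → ℤ) {q r : ℕ}

/-- Nested alternations over two blocks of letters are absorbed by the full alternation. -/
theorem alternation_alternation_blocks (Φ : (Fin q → P) → (Fin r → P) → W) (x : Fin (q + r) → P) :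
    alternation deg (fun y => alternation deg (fun u => alternation deg (Φ u)
      (y ∘ Fin.natAdd q)) (y ∘ Fin.castAdd r)) x =
    (q.factorial * r.factorial) •
      alternation deg (fun y => Φ (y ∘ Fin.castAdd r) (y ∘ Fin.natAdd q)) x := by
  have h1 : ∀ y : Fin (q + r) → P, alternation deg (fun u => alternation deg (Φ u)
      (y ∘ Fin.natAdd q)) (y ∘ Fin.castAdd r) = ∑ p : Equiv.Perm (Fin q) × Equiv.Perm (Fin r),
      signedReindex deg (blockPerm p.1 p.2)
        (fun y => Φ (y ∘ Fin.castAdd r) (y ∘ Fin.natAdd q)) y := by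
    intro y
    rw [Fintype.sum_prod_type]
    simp only [alternation, Finset.smul_sum]
    refine Finset.sum_congr rfl fun ρ _ => Finset.sum_congr rfl fun τ _ => ?_
    rw [signedReindex, altSign_blockPerm, mul_smul]
    have e1 : (y ∘ blockPerm ρ τ) ∘ Fin.castAdd r = (y ∘ Fin.castAdd r) ∘ ρ := by
      funext i
      simp [blockPerm_castAdd]
    have e2 : (y ∘ blockPerm ρ τ) ∘ Fin.natAdd q = (y ∘ Fin.natAdd q) ∘ τ := by
      funext i
      simp [blockPerm_natAdd]
    rw [e1, e2]
    rfl
  simp only [h1]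
  rw [alternation_sum]
  simp only [show ∀ κ Φ, alternation deg (fun y : Fin (q + r) → P => signedReindex deg κ Φ y) x =
    alternation (W := W) deg Φ x from fun κ Φ => alternation_signedReindex deg κ Φ x]
  simp [Fintype.card_perm]

end AlternationBlocks

/-! ### The Jacobiator as an alternated composition -/

section Composition

variable {k : Type*} [Field k] {A : Type*} [Ring A] [Algebra k A] {𝒜 : ℤ → Submodule k A}

open Homogeneous

/-- The insertion of `g (a j, …, a (j + q - 1))` at the position `j` of `f`. -/
def compAt {p q : ℕ} (f : MultilinearMap k (fun _ : Fin p => A) A)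
    (g : MultilinearMap k (fun _ : Fin q => A) A) (j : ℕ) (a : ℕ → A) : A :=
  f fun i : Fin p => if (i : ℕ) < j then a i else if (i : ℕ) = j then g fun l : Fin q => a (j + l)
    else a (i + q - 1)

/-- The signed sum of all insertions of `g` into `f` with `n` arguments in total. -/
def compositionSum (f g : ∀ n : ℕ, MultilinearMap k (fun _ : Fin n => A) A) (n : ℕ)
    (d : ℕ → ℤ) (a : ℕ → A) : A :=
  ∑ q ∈ Finset.range (n + 1), (q * (n - q) : ℤ).negOnePow •
    ∑ j ∈ Finset.range (n - q + 1),
      ((q - 1) * j + (∑ i ∈ Finset.range j, d i) * q : ℤ).negOnePow •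
        compAt (f (n - q + 1)) (g q) j a

/-- A finite word, continued by zeros. -/
def extendWord {n : ℕ} (x : Fin n → Homogeneous 𝒜) (i : ℕ) : Homogeneous 𝒜 :=
  if h : i < n then x ⟨i, h⟩ else ⟨0, 0⟩

theorem extendWord_of_lt {n : ℕ} (x : Fin n → Homogeneous 𝒜) {i : ℕ} (h : i < n) :
    extendWord x i = x ⟨i, h⟩ := dif_pos h

theorem prod_castSucc_lt_negOnePow {r : ℕ} (j : Fin (r + 1)) (g : ℕ → ℤ) :
    (∏ i : Fin r, if i.castSucc < j then (g i).negOnePow else 1) =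
      (∑ i ∈ Finset.range j, g i).negOnePow := by
  rw [← prod_negOnePow, show (∏ i : Fin r, if i.castSucc < j then (g i).negOnePow else 1) =
    ∏ i : Fin r, (fun m : ℕ => if m < j then (g m).negOnePow else 1) i from rfl,
    Fin.prod_univ_eq_prod_range (fun m : ℕ => if m < j then (g m).negOnePow else 1), ← Finset.prod_filter]
  refine Finset.prod_congr ?_ fun _ _ => rfl
  ext m
  have := j.2
  simp only [Finset.mem_filter, Finset.mem_range]
  omega

/-- For each passed letter of degree e, the block move and the A∞ sign together contribute the
parity q + eΣ + (q - 1) + eq ≡ 1 + e(Σ + 2 - q), where Σ is the total degree of the block. This is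
the sign of passing the single letter g(…), of degree Σ + 2 - q. -/
theorem signedReindex_blockMove {q r : ℕ} (f : MultilinearMap k (fun _ : Fin (r + 1) => A) A)
    (g : MultilinearMap k (fun _ : Fin q => A) A) (j : Fin (r + 1))
    (x : Fin (q + r) → Homogeneous 𝒜) :
    signedReindex deg (blockMove q j) (fun x =>
      ((q - 1) * (j : ℕ) + (∑ i ∈ Finset.range j, (extendWord x i).deg) * q : ℤ).negOnePow •
        compAt f g j (fun i => (extendWord x i).val)) x =
    insertSign j (∑ i, (x (Fin.castAdd r i)).deg + 2 - q) (deg ∘ x ∘ Fin.natAdd q) •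
      f (j.insertNth (g (val ∘ x ∘ Fin.castAdd r)) (val ∘ x ∘ Fin.natAdd q)) := by
  have hx : ∀ m (hm : m < q + r), extendWord (x ∘ blockMove q j) m = x ⟨if m < j then q + m
      else if m < j + q then m - j else m, by have := j.2; split_ifs <;> omega⟩ := by
    intro m hm
    rw [extendWord_of_lt _ hm, Function.comp_apply]
    rfl
  have hj := j.2
  rw [signedReindex, smul_smul]
  congr 1
  · rw [altSign_blockMove]
    have h1 : ((q - 1) * (j : ℕ) + (∑ i ∈ Finset.range j,
        (extendWord (x ∘ blockMove q j) i).deg) * q : ℤ) =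
        ∑ i ∈ Finset.range j, ((q - 1 : ℤ) + (extendWord (x ∘ blockMove q j) i).deg * q) := by
      rw [Finset.sum_add_distrib, Finset.sum_mul]
      simp only [Finset.sum_const, Finset.card_range, nsmul_eq_mul]
      ring
    rw [h1, ← prod_castSucc_lt_negOnePow, ← Finset.prod_mul_distrib, insertSign]
    refine Finset.prod_congr rfl fun i _ => ?_
    split_ifs with h
    · have h' : (i : ℕ) < j := h
      have h2 : extendWord (x ∘ blockMove q j) i = x (Fin.natAdd q i) := by
        rw [hx _ (by omega)]
        simp only [h', if_true]
        rfl
      rw [h2, exchangeSign_eq, ← Int.negOnePow_add]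
      simp only [Function.comp_apply]
      set e := (x (Fin.natAdd q i)).deg
      refine negOnePow_eq_of_sub_eq (q - 1 + e * q - e) ?_
      ring
    · simp
  · rw [compAt]
    congr 1
    refine Fin.eq_insertNth_iff.2 ⟨?_, ?_⟩
    · simp only [lt_irrefl, if_false, if_true]
      congr 1
      funext l
      rw [hx _ (by omega), Function.comp_apply, Function.comp_apply]
      congr 2
      ext
      simp
    · funext i
      rw [Fin.removeNth, Function.comp_apply, Function.comp_apply]
      by_cases h : i.castSucc < j
      · have h' : (i : ℕ) < j := h
        rw [Fin.succAbove_of_castSucc_lt _ _ h, Fin.val_castSucc, if_pos h', hx _ (by omega)]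
        congr 2
        ext
        simp [h']
      · have h' : ¬ (i : ℕ) < j := h
        rw [Fin.succAbove_of_le_castSucc _ _ (not_lt.1 h), Fin.val_succ, if_neg (by omega),
          if_neg (by omega), hx _ (by omega)]
        congr 2
        ext
        simp only [Fin.val_natAdd]
        split_ifs <;> omega

/-- Alternating f with g(…) as first letter puts that letter at every position j. The inner
alternations over the two blocks are absorbed by the outer one at the price of q! r!, which the
denominators of the Jacobiator remove. -/
theorem alternation_jacobi_term {q r : ℕ} (f : MultilinearMap k (fun _ : Fin (r + 1) => A) A)
    (g : MultilinearMap k (fun _ : Fin q => A) A) (hg : HasCochainDegree 𝒜 g)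
    (l : MultilinearMap k (fun _ : Fin (r + 1) => A) A)
    (hl : ∀ x : Fin (r + 1) → Homogeneous 𝒜, l (val ∘ x) = alternate f x)
    (x : Fin (q + r) → Homogeneous 𝒜) :
    alternation deg (fun x : Fin (q + r) → Homogeneous 𝒜 =>
      l (Fin.cons (alternate g (x ∘ Fin.castAdd r)) (val ∘ x ∘ Fin.natAdd q) :
        Fin (r + 1) → A)) x =
    (q.factorial * r.factorial) • alternation deg (fun x => ∑ j ∈ Finset.range (r + 1),
      ((q - 1) * j + (∑ i ∈ Finset.range j, (extendWord x i).deg) * q : ℤ).negOnePow •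
        compAt f g j (fun i => (extendWord x i).val)) x := by
  let Φ : (Fin q → Homogeneous 𝒜) → (Fin r → Homogeneous 𝒜) → A := fun u w =>
    ∑ j : Fin (r + 1), insertSign j (∑ i, (u i).deg + 2 - q) (deg ∘ w) •
      f (j.insertNth (g (val ∘ u)) (val ∘ w))
  have h1 : ∀ x : Fin (q + r) → Homogeneous 𝒜,
      l (Fin.cons (alternate g (x ∘ Fin.castAdd r)) (val ∘ x ∘ Fin.natAdd q) :
        Fin (r + 1) → A) = alternation deg (fun u => alternation deg (Φ u) (x ∘ Fin.natAdd q))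
          (x ∘ Fin.castAdd r) := by
    intro x
    have h2 : ∀ (w : Fin r → Homogeneous 𝒜) (b : A),
        l (Fin.cons b (val ∘ w) : Fin (r + 1) → A) =
        l.toLinearMap (Fin.cons 0 (val ∘ w) : Fin (r + 1) → A) 0 b := by
      intro w b
      simp
    rw [h2, alternate, alternation, map_sum, alternation]
    refine Finset.sum_congr rfl fun ρ _ => ?_
    rw [map_units_smul, ← h2]
    congr 1
    -- The value of g is homogeneous by `hg`, so it can serve as a letter of a word.
    let y : Homogeneous 𝒜 := ⟨_, _, hg ((x ∘ Fin.castAdd r) ∘ ρ)⟩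
    have h3 := hl (Fin.cons y (x ∘ Fin.natAdd q) : Fin (r + 1) → Homogeneous 𝒜)
    rw [alternate, alternation_cons] at h3
    have h4 : val ∘ (Fin.cons y (x ∘ Fin.natAdd q) : Fin (r + 1) → Homogeneous 𝒜) =
        Fin.cons y.val (val ∘ x ∘ Fin.natAdd q) := by
      funext i
      refine Fin.cases ?_ (fun i => ?_) i <;> simp
    rw [h4] at h3
    simp only [comp_insertNth] at h3
    exact h3
  simp only [h1]
  rw [alternation_alternation_blocks]
  congr 1
  simp only [Φ]
  rw [alternation_sum, alternation_sum, Finset.sum_range]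
  refine Finset.sum_congr rfl fun j _ => ?_
  rw [← alternation_signedReindex deg (blockMove q j) (fun x : Fin (q + r) → Homogeneous 𝒜 =>
      ((q - 1) * (j : ℕ) + (∑ i ∈ Finset.range j, (extendWord x i).deg) * q : ℤ).negOnePow •
        compAt f g j (fun i => (extendWord x i).val))]
  congr 1
  funext x
  rw [signedReindex_blockMove]
  rfl

theorem negOnePow_natCast_smul (m : ℕ) (a : A) : (m : ℤ).negOnePow • a = (-1 : k) ^ m • a := by
  rcases Nat.even_or_odd m with h | h
  · rw [h.neg_one_pow, Int.negOnePow_even _ (by exact_mod_cast h), one_smul, one_smul]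
  · rw [h.neg_one_pow, Int.negOnePow_odd _ (by exact_mod_cast h), Units.neg_smul, neg_smul,
      one_smul, one_smul]

/-- The alternation of the Jacobiator of the alternations of `f` is the alternation of `f ∘ f`. -/
theorem alternation_jacobiator [CharZero k]
    (f l : ∀ n : ℕ, MultilinearMap k (fun _ : Fin n => A) A) (hf : ∀ n, HasCochainDegree 𝒜 (f n))
    (hl : ∀ (n : ℕ) (x : Fin n → Homogeneous 𝒜), l n (val ∘ x) = alternate (f n) x)
    (n : ℕ) (x : Fin n → Homogeneous 𝒜) :
    alternation deg (fun x => jacobiator l n (val ∘ x)) x =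
      alternation deg (fun x => compositionSum f f n (fun i => (extendWord x i).deg)
        (fun i => (extendWord x i).val)) x := by
  unfold jacobiator compositionSum
  rw [alternation_sum, alternation_sum, Finset.sum_range]
  refine Finset.sum_congr rfl fun q _ => ?_
  obtain ⟨r, hr⟩ : ∃ r, n = q + r := ⟨n - q, by have := q.2; omega⟩
  obtain ⟨q, hq⟩ := q
  dsimp only at hr ⊢
  subst hr
  rw [alternation_smul, alternation_smul]
  -- The arity q + r - q occurs in the types of the arguments; the variable r' makes it replaceable
  -- by r.
  have key : ∀ r', r' = r → ∀ (h' : ∀ i : Fin r', q + i < q + r),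
      alternation deg (fun x : Fin (q + r) → Homogeneous 𝒜 => l (r' + 1) (Fin.cons
        (l q fun i : Fin q => (val ∘ x) ⟨i, by have := i.2; omega⟩)
        (fun i : Fin r' => (val ∘ x) ⟨q + i, h' i⟩) : Fin (r' + 1) → A)) x =
      (q.factorial * r'.factorial) • alternation deg (fun x => ∑ j ∈ Finset.range (r' + 1),
        ((q - 1) * j + (∑ i ∈ Finset.range j, (extendWord x i).deg) * q : ℤ).negOnePow •
        compAt (f (r' + 1)) (f q) j (fun i => (extendWord x i).val)) x := by
    rintro r' rfl h'
    rw [← alternation_jacobi_term (f (r' + 1)) (f q) (hf q) (l (r' + 1)) (hl (r' + 1))]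
    simp only [← hl]
    rfl
  have hqr : q + r - q = r := by omega
  rw [key (q + r - q) hqr, hqr, ← Nat.cast_smul_eq_nsmul k, smul_smul, Nat.cast_mul,
    div_mul_cancel₀, ← negOnePow_natCast_smul]
  · congr 2
    push_cast
    ring
  · exact mul_ne_zero (Nat.cast_ne_zero.2 (Nat.factorial_ne_zero _))
      (Nat.cast_ne_zero.2 (Nat.factorial_ne_zero _))

end Composition

/-! ### Coefficients of formal series and of multilinear maps -/

namespace FormalSeries

variable {k : Type*} [Field k] {A : Type*} [Ring A] [Algebra k A]

theorem coeff_add (i : ℕ) (a b : FormalSeries A) : (a + b).coeff i = a.coeff i + b.coeff i :=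
  map_add (PowerSeries.coeff (R := A) i) a b

theorem coeff_zero (i : ℕ) : (0 : FormalSeries A).coeff i = 0 :=
  map_zero (PowerSeries.coeff (R := A) i)

/-- The coefficient of `εⁱ`, as an additive map. -/
def coeffHom (i : ℕ) : FormalSeries A →+ A where
  toFun := coeff i
  map_zero' := coeff_zero i
  map_add' := coeff_add i

theorem coeff_sum {ι : Type*} (s : Finset ι) (i : ℕ) (a : ι → FormalSeries A) :
    (∑ j ∈ s, a j).coeff i = ∑ j ∈ s, (a j).coeff i :=
  map_sum (coeffHom i) a s

theorem coeff_units_smul (i : ℕ) (u : ℤˣ) (a : FormalSeries A) :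
    (u • a).coeff i = u • a.coeff i :=
  map_units_smul (coeffHom i) u a

@[ext]
theorem ext {a b : FormalSeries A} (h : ∀ i, a.coeff i = b.coeff i) : a = b :=
  PowerSeries.ext h

theorem coeff_const_zero (a : A) : (const a).coeff 0 = a :=
  PowerSeries.coeff_zero_C a

theorem coeff_const_succ (i : ℕ) (a : A) : (const a).coeff (i + 1) = 0 :=
  PowerSeries.coeff_C_of_ne_zero (Nat.succ_ne_zero i)

theorem smul_def (c : PowerSeries k) (a : FormalSeries A) :
    c • a = (PowerSeries.map (algebraMap k A) c * (show PowerSeries A from a) : PowerSeries A) := rfl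

theorem coeff_X_smul_zero (a : FormalSeries A) : ((PowerSeries.X : PowerSeries k) • a).coeff 0 = 0 := by
  rw [smul_def, PowerSeries.map_X]
  exact PowerSeries.coeff_zero_X_mul _

theorem coeff_X_smul_succ (i : ℕ) (a : FormalSeries A) :
    ((PowerSeries.X : PowerSeries k) • a).coeff (i + 1) = a.coeff i := by
  rw [smul_def, PowerSeries.map_X]
  exact PowerSeries.coeff_succ_X_mul _ _

theorem coeff_C_smul (i : ℕ) (c : k) (a : FormalSeries A) :
    (PowerSeries.C c • a).coeff i = c • a.coeff i := by
  rw [smul_def, PowerSeries.map_C, Algebra.smul_def]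
  exact PowerSeries.coeff_C_mul _ _ _

theorem const_add (a b : A) : const (a + b) = const a + const b :=
  map_add (PowerSeries.C (R := A)) a b

theorem const_smul (c : k) (a : A) : const (c • a) = (PowerSeries.C c : PowerSeries k) • const a := by
  ext i
  rw [coeff_C_smul]
  cases i with
  | zero => rw [coeff_const_zero, coeff_const_zero]
  | succ i => rw [coeff_const_succ, coeff_const_succ, smul_zero]

/-- The quotient of `a - a₀` by `ε`. -/
def shift (a : FormalSeries A) : FormalSeries A := PowerSeries.mk fun i => a.coeff (i + 1)

theorem coeff_shift (i : ℕ) (a : FormalSeries A) : a.shift.coeff i = a.coeff (i + 1) :=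
  PowerSeries.coeff_mk _ _

variable (k) in
theorem eq_const_add_X_smul_shift (a : FormalSeries A) :
    a = const (a.coeff 0) + (PowerSeries.X : PowerSeries k) • a.shift := by
  ext i
  rw [coeff_add]
  cases i with
  | zero => rw [coeff_const_zero, coeff_X_smul_zero, add_zero]
  | succ i => rw [coeff_const_succ, coeff_X_smul_succ, coeff_shift, zero_add]

theorem const_mem_grading {𝒜 : ℤ → Submodule k A} {j : ℤ} {a : A} (ha : a ∈ 𝒜 j) :
    const a ∈ grading 𝒜 j := by
  intro i
  cases i with
  | zero => rwa [coeff_const_zero]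
  | succ i => rw [coeff_const_succ]; exact (𝒜 j).zero_mem

theorem shift_mem_grading {𝒜 : ℤ → Submodule k A} {j : ℤ} {a : FormalSeries A}
    (ha : a ∈ grading 𝒜 j) : a.shift ∈ grading 𝒜 j := by
  intro i
  rw [coeff_shift]
  exact ha _

end FormalSeries

section Coefficients

variable {k : Type*} [Field k] {A : Type*} [Ring A] [Algebra k A]

open FormalSeries

/-- The coefficient of `εⁱ` of a multilinear map on formal series. -/
def coeffMap {n : ℕ} (F : MultilinearMap (PowerSeries k) (fun _ : Fin n => FormalSeries A)
    (FormalSeries A)) (i : ℕ) : MultilinearMap k (fun _ : Fin n => A) A where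
  toFun a := (F (const ∘ a)).coeff i
  map_update_add' a j x y := by
    rw [Function.comp_update, Function.comp_update, Function.comp_update, const_add,
      MultilinearMap.map_update_add, coeff_add]
  map_update_smul' a j c x := by
    rw [Function.comp_update, Function.comp_update, const_smul,
      MultilinearMap.map_update_smul, coeff_C_smul]

theorem coeffMap_apply {n : ℕ} (F : MultilinearMap (PowerSeries k)
    (fun _ : Fin n => FormalSeries A) (FormalSeries A)) (i : ℕ) (a : Fin n → A) :
    coeffMap F i a = (F (const ∘ a)).coeff i := rfl

variable {n : ℕ} (F : MultilinearMap (PowerSeries k) (fun _ : Fin n => FormalSeries A)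
    (FormalSeries A))

theorem coeff_zero_update (b : Fin n → FormalSeries A) (j : Fin n) (y : FormalSeries A) :
    (F (Function.update b j y)).coeff 0 = (F (Function.update b j (const (y.coeff 0)))).coeff 0 := by
  conv_lhs => rw [eq_const_add_X_smul_shift k y]
  rw [MultilinearMap.map_update_add, MultilinearMap.map_update_smul, coeff_add, coeff_X_smul_zero,
    add_zero]

/-- Since F is linear over power series, splitting y as its constant term plus ε times `y.shift`
lowers the order by one in the second summand. -/
theorem coeff_succ_update (i : ℕ) (b : Fin n → FormalSeries A) (j : Fin n) (y : FormalSeries A) :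
    (F (Function.update b j y)).coeff (i + 1) =
      (F (Function.update b j (const (y.coeff 0)))).coeff (i + 1) +
        (F (Function.update b j y.shift)).coeff i := by
  conv_lhs => rw [eq_const_add_X_smul_shift k y]
  rw [MultilinearMap.map_update_add, MultilinearMap.map_update_smul, coeff_add, coeff_X_smul_succ]

theorem coeff_one_update_const (b : Fin n → A) (j : Fin n) (y : FormalSeries A) :
    (F (Function.update (const ∘ b) j y)).coeff 1 =
      coeffMap F 1 (Function.update b j (y.coeff 0)) +
        coeffMap F 0 (Function.update b j (y.coeff 1)) := by
  rw [coeff_succ_update, coeff_zero_update, coeff_shift, coeffMap_apply, coeffMap_apply,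
    Function.comp_update, Function.comp_update]

theorem coeff_two_update_const (b : Fin n → A) (j : Fin n) (y : FormalSeries A) :
    (F (Function.update (const ∘ b) j y)).coeff 2 =
      coeffMap F 2 (Function.update b j (y.coeff 0)) +
        (coeffMap F 1 (Function.update b j (y.coeff 1)) +
          coeffMap F 0 (Function.update b j (y.coeff 2))) := by
  rw [coeff_succ_update, coeff_one_update_const, coeff_shift, coeff_shift, coeffMap_apply _ 2,
    Function.comp_update]

end Coefficients

/-! ### The A∞ relations to first and second order -/

section Relations

variable {k : Type*} [Field k] {A : Type*} [Ring A] [Algebra k A] {𝒜 : ℤ → Submodule k A}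

open FormalSeries Homogeneous

theorem compAt_eq_update {p q : ℕ} (f : MultilinearMap k (fun _ : Fin p => A) A)
    (g : MultilinearMap k (fun _ : Fin q => A) A) {j : ℕ} (hj : j < p) (a : ℕ → A) :
    compAt f g j a = f (Function.update
      (fun i : Fin p => if (i : ℕ) < j then a i else a (i + q - 1)) ⟨j, hj⟩
      (g fun l : Fin q => a (j + l))) := by
  rw [compAt]
  congr 1
  funext i
  by_cases h : i = ⟨j, hj⟩
  · subst h
    simp
  · rw [Function.update_of_ne h]
    have h' : (i : ℕ) ≠ j := fun h' => h (Fin.ext h')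
    simp only [h', if_false]

variable (μ : ∀ n : ℕ, MultilinearMap (PowerSeries k) (fun _ : Fin n => FormalSeries A)
  (FormalSeries A))

theorem hasCochainDegree_coeffMap (hμ : IsAInfinity (FormalSeries.grading 𝒜) μ) (n i : ℕ) :
    HasCochainDegree 𝒜 (coeffMap (μ n) i) := fun x =>
  hμ.map_mem n (deg ∘ x) (const ∘ val ∘ x) (fun j => const_mem_grading (x j).val_mem) i

/-- The inner operation is the only argument that is not a constant series, so coefficients can be
extracted in one slot. At i = j the entry `a (i + q - 1)` is overwritten, so truncated subtraction
there is harmless. -/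
theorem relation_arg_eq_update {p q j : ℕ} (hj : j < p) (G : (Fin q → FormalSeries A) → FormalSeries A)
    (a : ℕ → A) : (fun i : Fin p => if (i : ℕ) < j then const (a i)
      else if (i : ℕ) = j then G (fun l : Fin q => const (a (j + l))) else const (a (i + q - 1))) =
    Function.update (const ∘ fun i : Fin p => if (i : ℕ) < j then a i else a (i + q - 1)) ⟨j, hj⟩
      (G (const ∘ fun l : Fin q => a (j + l))) := by
  funext i
  by_cases h : i = ⟨j, hj⟩
  · subst h
    simp [Function.comp_def]
  · rw [Function.update_of_ne h]
    have h' : (i : ℕ) ≠ j := fun h' => h (Fin.ext h')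
    simp only [h', if_false, Function.comp_apply]
    split_ifs <;> rfl

theorem coeff_one_relation (hμ : IsAInfinity (FormalSeries.grading 𝒜) μ) {n : ℕ}
    (x : Fin n → Homogeneous 𝒜) :
    compositionSum (fun n => coeffMap (μ n) 0) (fun n => coeffMap (μ n) 1) n
        (fun i => (extendWord x i).deg) (fun i => (extendWord x i).val) +
      compositionSum (fun n => coeffMap (μ n) 1) (fun n => coeffMap (μ n) 0) n
        (fun i => (extendWord x i).deg) (fun i => (extendWord x i).val) = 0 := by
  have h := congrArg (FormalSeries.coeff 1) (hμ.relation n (fun i => (extendWord x i).deg)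
    (fun i => const (extendWord x i).val) fun i _ => const_mem_grading (extendWord x i).val_mem)
  rw [FormalSeries.coeff_zero, FormalSeries.coeff_sum] at h
  rw [← h, compositionSum, compositionSum, ← Finset.sum_add_distrib]
  refine Finset.sum_congr rfl fun q _ => ?_
  rw [FormalSeries.coeff_units_smul, FormalSeries.coeff_sum, ← smul_add, ← Finset.sum_add_distrib]
  refine congrArg _ (Finset.sum_congr rfl fun j hj => ?_)
  have hj' := Finset.mem_range.1 hj
  have h' := relation_arg_eq_update hj' (μ q) fun i => (extendWord x i).val
  beta_reduce at h'
  rw [FormalSeries.coeff_units_smul, ← smul_add, h', coeff_one_update_const,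
    compAt_eq_update _ _ hj', compAt_eq_update _ _ hj']
  exact congrArg _ (add_comm _ _)

theorem coeff_two_relation (hμ : IsAInfinity (FormalSeries.grading 𝒜) μ) {n : ℕ}
    (x : Fin n → Homogeneous 𝒜) :
    compositionSum (fun n => coeffMap (μ n) 1) (fun n => coeffMap (μ n) 1) n
        (fun i => (extendWord x i).deg) (fun i => (extendWord x i).val) +
    (compositionSum (fun n => coeffMap (μ n) 0) (fun n => coeffMap (μ n) 2) n
        (fun i => (extendWord x i).deg) (fun i => (extendWord x i).val) +
      compositionSum (fun n => coeffMap (μ n) 2) (fun n => coeffMap (μ n) 0) n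
        (fun i => (extendWord x i).deg) (fun i => (extendWord x i).val)) = 0 := by
  have h := congrArg (FormalSeries.coeff 2) (hμ.relation n (fun i => (extendWord x i).deg)
    (fun i => const (extendWord x i).val) fun i _ => const_mem_grading (extendWord x i).val_mem)
  rw [FormalSeries.coeff_zero, FormalSeries.coeff_sum] at h
  rw [← h, compositionSum, compositionSum, compositionSum, ← Finset.sum_add_distrib,
    ← Finset.sum_add_distrib]
  refine Finset.sum_congr rfl fun q _ => ?_
  rw [FormalSeries.coeff_units_smul, FormalSeries.coeff_sum, ← smul_add, ← smul_add,
    ← Finset.sum_add_distrib, ← Finset.sum_add_distrib]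
  refine congrArg _ (Finset.sum_congr rfl fun j hj => ?_)
  have hj' := Finset.mem_range.1 hj
  have h' := relation_arg_eq_update hj' (μ q) fun i => (extendWord x i).val
  beta_reduce at h'
  rw [FormalSeries.coeff_units_smul, ← smul_add, ← smul_add, h', coeff_two_update_const,
    compAt_eq_update _ _ hj', compAt_eq_update _ _ hj', compAt_eq_update _ _ hj']
  exact congrArg _ ((add_assoc _ _ _).symm.trans (add_comm _ _))

section Product

variable (m g : ∀ n : ℕ, MultilinearMap k (fun _ : Fin n => A) A)
  (hm₂ : ∀ a : Fin 2 → A, m 2 a = a 0 * a 1) (hm : ∀ n ≠ 2, ∀ a : Fin n → A, m n a = 0)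

include hm

/-- With no arguments there is nothing to multiply; this arity is separate because a coboundary
takes at least one argument. -/
theorem compositionSum_product_zero (d : ℕ → ℤ) (a : ℕ → A) :
    compositionSum m g 0 d a + compositionSum g m 0 d a = 0 := by
  have h1 : compAt (g 1) (m 0) 0 a = 0 := by
    rw [compAt_eq_update _ _ one_pos, hm 0 (by norm_num)]
    exact MultilinearMap.map_update_zero _ _ _
  have h2 : compAt (m 1) (g 0) 0 a = 0 := hm 1 (by norm_num) _
  simp [compositionSum, h1, h2]

include hm₂

/-- Only q = n leaves the outer operation binary. The inner one then fills its first or its second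
slot, which gives the two outer terms of the coboundary. -/
theorem compositionSum_product_left {n : ℕ} (x : Fin (n + 1) → Homogeneous 𝒜) :
    compositionSum m g (n + 1) (fun i => (extendWord x i).deg) (fun i => (extendWord x i).val) =
      (n : ℤ).negOnePow • (g n (val ∘ Fin.init x) * (x (Fin.last n)).val)
        - (n * (x 0).deg).negOnePow • ((x 0).val * g n (val ∘ Fin.tail x)) := by
  rw [compositionSum, Finset.sum_eq_single n]
  · rw [show n + 1 - n = 1 by omega, Finset.sum_range_succ, Finset.sum_range_one]
    have e1 : (fun l : Fin n => (extendWord x (0 + l)).val) = val ∘ Fin.init x := by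
      funext l
      rw [extendWord_of_lt _ (by omega), Function.comp_apply, Fin.init]
      congr 2
      ext
      simp
    have e2 : (fun l : Fin n => (extendWord x (1 + l)).val) = val ∘ Fin.tail x := by
      funext l
      rw [extendWord_of_lt _ (by omega), Function.comp_apply, Fin.tail]
      congr 2
      ext
      simp [add_comm]
    have e3 : (extendWord x 0) = x 0 := extendWord_of_lt x (Nat.succ_pos n)
    have e4 : (extendWord x (1 + n - 1)) = x (Fin.last n) := by
      rw [extendWord_of_lt _ (by omega)]
      congr 1
      ext
      simp
    rw [compAt, compAt, hm₂, hm₂]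
    simp only [Fin.val_zero, Fin.val_one, lt_irrefl, if_false, if_true, not_lt_zero,
      one_ne_zero, zero_lt_one, e1, e2, e3, e4]
    rw [smul_add, smul_smul, smul_smul, ← Int.negOnePow_add, ← Int.negOnePow_add,
      sub_eq_add_neg (_ • _), ← Units.neg_smul, ← Int.negOnePow_succ]
    congr 2
    · refine negOnePow_eq_of_sub_eq 0 ?_
      push_cast
      simp
    · refine negOnePow_eq_of_sub_eq (n - 1) ?_
      rw [Finset.sum_range_one, e3]
      push_cast
      ring
  · intro q hq hqn
    have hq' := Finset.mem_range.1 hq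
    rw [Finset.sum_eq_zero, smul_zero]
    intro j _
    rw [compAt, hm _ (by omega), smul_zero]
  · intro h
    exact absurd (Finset.mem_range.2 (by omega)) h

/-- Only q = 2 survives, and inserting the product means merging two neighbours. -/
theorem compositionSum_product_right {n : ℕ} (x : Fin (n + 1) → Homogeneous 𝒜) :
    compositionSum g m (n + 1) (fun i => (extendWord x i).deg) (fun i => (extendWord x i).val) =
      ∑ j : Fin n, (j : ℤ).negOnePow • g n (mergeWord j (val ∘ x)) := by
  have h0 : ∀ q ∈ Finset.range (n + 1 + 1), q ≠ 2 → (q * ((n + 1 : ℕ) - q) : ℤ).negOnePow •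
      ∑ j ∈ Finset.range (n + 1 - q + 1),
      ((q - 1) * j + (∑ i ∈ Finset.range j, (extendWord x i).deg) * q : ℤ).negOnePow •
        compAt (g (n + 1 - q + 1)) (m q) j (fun i => (extendWord x i).val) = 0 := by
    intro q _ hq2
    rw [Finset.sum_eq_zero, smul_zero]
    intro j hj
    rw [compAt_eq_update _ _ (Finset.mem_range.1 hj), hm _ hq2, MultilinearMap.map_update_zero, smul_zero]
  rcases n with _ | n
  · rw [compositionSum, Finset.sum_eq_zero]
    · simp
    · intro q hq
      have := Finset.mem_range.1 hq
      exact h0 q hq (by omega)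
  · rw [compositionSum, Finset.sum_eq_single 2 h0]
    · rw [show n + 1 + 1 - 2 = n by omega, Finset.sum_range]
      rw [Int.negOnePow_even _ (by simp), one_smul]
      refine Finset.sum_congr rfl fun j _ => ?_
      congr 1
      · refine negOnePow_eq_of_sub_eq (∑ i ∈ Finset.range j, (extendWord x i).deg) ?_
        push_cast
        ring
      · rw [compAt]
        congr 1
        funext i
        rw [mergeWord, hm₂]
        have hi := i.2
        have hj := j.2
        simp only [Fin.lt_def, Fin.ext_iff, Function.comp_apply]
        split_ifs with h1 h2
        · rw [extendWord_of_lt _ (by omega)]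
          rfl
        · rw [extendWord_of_lt _ (by rw [Fin.val_zero]; omega), extendWord_of_lt _ (by rw [Fin.val_one]; omega)]
          congr 3 <;> ext <;> simp [h2]
        · rw [extendWord_of_lt _ (by omega)]
          congr 2
    · intro h
      exact absurd (Finset.mem_range.2 (by omega)) h

end Product

end Relations

/-! ### Divisibility by ε and the first-order bracket -/

section AlternationMap

variable {R V V' : Type*} [CommRing R] [AddCommGroup V] [Module R V] [AddCommGroup V'] [Module R V']

/-- The alternation of a multilinear map, with the Koszul signs for letters of degrees `d`. -/
def alternationMap {n : ℕ} (d : Fin n → ℤ) (F : MultilinearMap R (fun _ : Fin n => V) V') :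
    MultilinearMap R (fun _ : Fin n => V) V' :=
  ∑ σ : Equiv.Perm (Fin n), altSign d σ • F.domDomCongr σ

theorem alternationMap_apply {n : ℕ} (d : Fin n → ℤ)
    (F : MultilinearMap R (fun _ : Fin n => V) V') (a : Fin n → V) :
    alternationMap d F a = alternationSum d F a := by
  rw [alternationMap, sum_apply, alternationSum_eq]
  rfl

end AlternationMap

section FirstOrder

variable {k : Type*} [Field k] [CharZero k] {A : Type*} [Ring A] [Algebra k A]
  {𝒜 : ℤ → Submodule k A}

open FormalSeries Homogeneous

theorem alternation_mul (h : IsGradedCommutative 𝒜) (x : Fin 2 → Homogeneous 𝒜) :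
    alternation deg (fun y => (y 0).val * (y 1).val) x = 0 := by
  have : IsAddTorsionFree A := .of_isTorsionFree k A
  refine alternation_eq_zero_of_signedReindex_eq_neg deg (Equiv.swap 0 1) _ (fun y => ?_) x
  rw [signedReindex, altSign_swap_zero_one]
  simp only [Function.comp_apply, Equiv.swap_apply_left, Equiv.swap_apply_right]
  rw [Homogeneous.mul_comm h, smul_smul, exchangeSign, _root_.mul_comm (y 1).deg, neg_mul,
    Int.units_mul_self, Units.neg_smul, one_smul]

variable (μ : ∀ n : ℕ, MultilinearMap (PowerSeries k) (fun _ : Fin n => FormalSeries A)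
  (FormalSeries A))

theorem coeff_alternationSum {n : ℕ} (i : ℕ) (d : Fin n → ℤ)
    (F : (Fin n → FormalSeries A) → FormalSeries A) (a : Fin n → FormalSeries A) :
    (alternationSum d F a).coeff i = alternationSum d (fun a => (F a).coeff i) a := by
  rw [alternationSum_eq, FormalSeries.coeff_sum]
  exact Finset.sum_congr rfl fun σ _ => coeff_units_smul _ _ _

variable {μ}

theorem coeff_zero_alternationSum (h : IsGradedCommutative 𝒜) (hred : ReducesToProduct μ) {n : ℕ}
    (d : Fin n → ℤ) (a : Fin n → FormalSeries A) (ha : ∀ i, a i ∈ FormalSeries.grading 𝒜 (d i)) :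
    (alternationSum d (μ n) a).coeff 0 = 0 := by
  rw [coeff_alternationSum]
  by_cases hn : n = 2
  · subst hn
    simp only [hred.1]
    exact alternation_mul h fun i => ⟨d i, (a i).coeff 0, ha i 0⟩
  · simp only [hred.2 n hn]
    exact Finset.sum_eq_zero fun σ _ => smul_zero _

/-- Replacing an argument by its constant term changes the coefficient of ε by the zeroth
coefficient of an alternation in which that argument is shifted. The shift keeps its degree, so this
coefficient vanishes. -/
theorem coeff_one_alternationSum (h : IsGradedCommutative 𝒜) (hred : ReducesToProduct μ) {n : ℕ}
    (d : Fin n → ℤ) (a : Fin n → FormalSeries A) (ha : ∀ i, a i ∈ FormalSeries.grading 𝒜 (d i)) :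
    (alternationSum d (μ n) a).coeff 1 =
      alternationSum d (coeffMap (μ n) 1) fun i => (a i).coeff 0 := by
  -- The arguments are replaced one at a time. Freezing the degrees d makes the alternation
  -- multilinear, which this requires.
  have key : ∀ s : Finset (Fin n), (alternationMap d (μ n) a).coeff 1 =
      (alternationMap d (μ n) fun i => if i ∈ s then const ((a i).coeff 0) else a i).coeff 1 := by
    intro s
    induction s using Finset.induction_on with
    | empty => simp
    | insert j s hj ih =>
      have h1 : (fun i => if i ∈ s then const ((a i).coeff 0) else a i) =
          Function.update (fun i => if i ∈ s then const ((a i).coeff 0) else a i) j (a j) := by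
        rw [eq_comm, Function.update_eq_self_iff]
        simp [hj]
      have h2 : (fun i => if i ∈ insert j s then const ((a i).coeff 0) else a i) =
          Function.update (fun i => if i ∈ s then const ((a i).coeff 0) else a i) j
            (const ((a j).coeff 0)) := by
        funext i
        by_cases hi : i = j
        · subst hi
          simp
        · rw [Function.update_of_ne hi]
          simp [hi]
      rw [ih, h1, coeff_succ_update, ← h2, alternationMap_apply _ _ (Function.update _ _ _),
        coeff_zero_alternationSum h hred, add_zero]
      intro i
      by_cases hi : i = j
      · subst hi
        rw [Function.update_self]
        exact shift_mem_grading (ha i)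
      · rw [Function.update_of_ne hi]
        split_ifs
        · exact const_mem_grading (ha i 0)
        · exact ha i
  rw [← alternationMap_apply, key Finset.univ, alternationMap_apply, coeff_alternationSum]
  simp only [Finset.mem_univ, if_true]
  rfl

theorem isFirstOrderAlternation_iff (h : IsGradedCommutative 𝒜) (hred : ReducesToProduct μ)
    (l : ∀ n : ℕ, MultilinearMap k (fun _ : Fin n => A) A) :
    IsFirstOrderAlternation 𝒜 μ l ↔
      ∀ (n : ℕ) (x : Fin n → Homogeneous 𝒜), l n (val ∘ x) = alternate (coeffMap (μ n) 1) x := by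
  constructor
  · intro hl n x
    obtain ⟨b, hb, hb0⟩ := hl n (deg ∘ x) (const ∘ val ∘ x)
      fun i => const_mem_grading (x i).val_mem
    have h1 := coeff_one_alternationSum h hred (deg ∘ x) (const ∘ val ∘ x)
      fun i => const_mem_grading (x i).val_mem
    rw [hb, coeff_X_smul_succ, hb0] at h1
    simp only [Function.comp_apply, coeff_const_zero] at h1
    exact h1
  · intro hl n d a ha
    refine ⟨(alternationSum d (μ n) a).shift, ?_, ?_⟩
    · conv_lhs => rw [eq_const_add_X_smul_shift k (alternationSum d (μ n) a),
        coeff_zero_alternationSum h hred d a ha]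
      rw [show const (0 : A) = 0 from map_zero (PowerSeries.C (R := A)), zero_add]
    · rw [coeff_shift, zero_add, coeff_one_alternationSum h hred d a ha]
      exact (hl n fun i => ⟨d i, (a i).coeff 0, ha i 0⟩).symm

end FirstOrder

/-! ### Extension from homogeneous elements -/

section Existence

variable {k : Type*} [Field k] {A : Type*} [Ring A] [Algebra k A] {𝒜 : ℤ → Submodule k A}

open Homogeneous

/-- The projections to the homogeneous components. -/
theorem exists_projections (h : DirectSum.IsInternal 𝒜) (s : Finset ℤ) (hs : ∀ j ∉ s, 𝒜 j = ⊥) :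
    ∃ π : ℤ → A →ₗ[k] A, (∀ j a, π j a ∈ 𝒜 j) ∧ (∀ j, ∀ a ∈ 𝒜 j, π j a = a) ∧
      (∀ i j, i ≠ j → ∀ a ∈ 𝒜 i, π j a = 0) ∧ ∀ a, ∑ j ∈ s, π j a = a := by
  classical
  let := h.chooseDecomposition
  refine ⟨fun j => (𝒜 j).subtype ∘ₗ DirectSum.component k ℤ (fun j => 𝒜 j) j ∘ₗ
    (DirectSum.decomposeLinearEquiv 𝒜).toLinearMap, fun j a => Subtype.mem _, fun j a ha => ?_,
    fun i j hij a ha => ?_, fun a => ?_⟩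
  · exact DirectSum.decompose_of_mem_same 𝒜 ha
  · exact DirectSum.decompose_of_mem_ne 𝒜 ha hij
  · refine Eq.trans ?_ (DirectSum.sum_support_decompose 𝒜 a)
    refine (Finset.sum_subset ?_ ?_).symm
    · intro j hj
      by_contra hjs
      rw [DFinsupp.mem_support_iff] at hj
      refine hj (Subtype.ext ?_)
      exact (Submodule.eq_bot_iff _).1 (hs j hjs) _ (DirectSum.decompose 𝒜 a j).2
    · intro j _ hj
      rw [DFinsupp.notMem_support_iff] at hj
      exact congrArg Subtype.val hj

/-- The alternation with fixed degrees is multilinear; composing it with the projections to these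
degrees and summing over the finitely many degree vectors in s selects the correct signs. -/
theorem exists_alternate (h : DirectSum.IsInternal 𝒜) (s : Finset ℤ) (hs : ∀ j ∉ s, 𝒜 j = ⊥)
    {n : ℕ} (f : MultilinearMap k (fun _ : Fin n => A) A) :
    ∃ l : MultilinearMap k (fun _ : Fin n => A) A,
      ∀ x : Fin n → Homogeneous 𝒜, l (val ∘ x) = alternate f x := by
  classical
  obtain ⟨π, -, hπ, hπ', -⟩ := exists_projections h s hs
  refine ⟨∑ d ∈ Fintype.piFinset fun _ : Fin n => s,
    (alternationMap d f).compLinearMap fun i => π (d i), fun x => ?_⟩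
  have h1 : alternate f x = alternationMap (deg ∘ x) f (val ∘ x) := by
    rw [alternationMap_apply]
    rfl
  rw [h1, sum_apply]
  by_cases hx : ∀ i, deg (x i) ∈ s
  · rw [Finset.sum_eq_single (deg ∘ x)]
    · rw [MultilinearMap.compLinearMap_apply]
      congr 1
      funext i
      exact hπ _ _ (x i).val_mem
    · intro d _ hd
      obtain ⟨i, hi⟩ := Function.ne_iff.1 hd
      rw [MultilinearMap.compLinearMap_apply]
      exact MultilinearMap.map_coord_zero _ i (hπ' _ _ hi.symm _ (x i).val_mem)
    · intro hd
      exact absurd (Fintype.mem_piFinset.2 hx) hd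
  -- A letter whose degree lies outside s is zero, so both sides vanish.
  · push Not at hx
    obtain ⟨i, hi⟩ := hx
    have h0 : (val ∘ x) i = 0 := by
      have := (x i).val_mem
      rw [hs _ hi] at this
      exact (Submodule.mem_bot k).1 this
    rw [MultilinearMap.map_coord_zero _ i h0]
    refine Finset.sum_eq_zero fun d _ => ?_
    rw [MultilinearMap.compLinearMap_apply]
    exact MultilinearMap.map_coord_zero _ i (by rw [h0, map_zero])

theorem multilinear_ext_homogeneous (h : DirectSum.IsInternal 𝒜) (s : Finset ℤ)
    (hs : ∀ j ∉ s, 𝒜 j = ⊥) {n : ℕ} {l l' : MultilinearMap k (fun _ : Fin n => A) A}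
    (hl : ∀ x : Fin n → Homogeneous 𝒜, l (val ∘ x) = l' (val ∘ x)) : l = l' := by
  classical
  obtain ⟨π, hπ, -, -, hsum⟩ := exists_projections h s hs
  refine MultilinearMap.ext fun a => ?_
  rw [show a = fun i => ∑ j ∈ s, π j (a i) from funext fun i => (hsum (a i)).symm,
    MultilinearMap.map_sum_finset, MultilinearMap.map_sum_finset]
  exact Finset.sum_congr rfl fun r _ => hl fun i => ⟨r i, π (r i) (a i), hπ _ _⟩

end Existence

/-! ### The P∞-structure over a graded commutative algebra -/

section Reduction

variable {k : Type*} [Field k] {A : Type*} [Ring A] [Algebra k A]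
  {μ : ∀ n : ℕ, MultilinearMap (PowerSeries k) (fun _ : Fin n => FormalSeries A) (FormalSeries A)}

open FormalSeries

theorem coeffMap_zero_two (hred : ReducesToProduct μ) (a : Fin 2 → A) :
    coeffMap (μ 2) 0 a = a 0 * a 1 := by
  rw [coeffMap_apply, hred.1, Function.comp_apply, Function.comp_apply, coeff_const_zero,
    coeff_const_zero]

theorem coeffMap_zero_of_ne_two (hred : ReducesToProduct μ) (n : ℕ) (hn : n ≠ 2) (a : Fin n → A) :
    coeffMap (μ n) 0 a = 0 := hred.2 n hn _

variable {𝒜 : ℤ → Submodule k A}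

theorem hochschildCoboundary_coeffMap_one (hμ : IsAInfinity (FormalSeries.grading 𝒜) μ)
    (hred : ReducesToProduct μ) {n : ℕ} (x : Fin (n + 1) → Homogeneous 𝒜) :
    hochschildCoboundary (coeffMap (μ n) 1) x = 0 := by
  have h := coeff_one_relation μ hμ x
  rwa [compositionSum_product_left (fun n => coeffMap (μ n) 0) _ (coeffMap_zero_two hred)
    (coeffMap_zero_of_ne_two hred),
    compositionSum_product_right (fun n => coeffMap (μ n) 0) _ (coeffMap_zero_two hred)
    (coeffMap_zero_of_ne_two hred)] at h

end Reduction

section Main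

variable {k : Type*} [Field k] [CharZero k] {A : Type*} [Ring A] [Algebra k A]
  {𝒜 : ℤ → Submodule k A}
  {μ : ∀ n : ℕ, MultilinearMap (PowerSeries k) (fun _ : Fin n => FormalSeries A) (FormalSeries A)}

open FormalSeries Homogeneous

theorem existsUnique_isFirstOrderAlternation (h : IsGradedCommutative 𝒜) (s : Finset ℤ)
    (hs : ∀ j ∉ s, 𝒜 j = ⊥) (hred : ReducesToProduct μ) :
    ∃! l : ∀ n : ℕ, MultilinearMap k (fun _ : Fin n => A) A, IsFirstOrderAlternation 𝒜 μ l := by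
  choose l hl using fun n => exists_alternate h.isInternal s hs (coeffMap (μ n) 1)
  refine ⟨l, (isFirstOrderAlternation_iff h hred l).2 hl, fun l' hl' => ?_⟩
  funext n
  refine multilinear_ext_homogeneous h.isInternal s hs fun x => ?_
  rw [hl, (isFirstOrderAlternation_iff h hred l').1 hl']

/-- At order ε², f ∘ f is minus the coboundary of the second-order coefficient of μ, and
coboundaries alternate to zero. -/
theorem alternation_compositionSum_coeffMap_one (hA : IsGradedCommutative 𝒜)
    (hμ : IsAInfinity (FormalSeries.grading 𝒜) μ)
    (hred : ReducesToProduct μ) {n : ℕ} (x : Fin n → Homogeneous 𝒜) :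
    alternation deg (fun x => compositionSum (fun n => coeffMap (μ n) 1)
      (fun n => coeffMap (μ n) 1) n (fun i => (extendWord x i).deg)
        (fun i => (extendWord x i).val)) x = 0 := by
  have h : ∀ x : Fin n → Homogeneous 𝒜, _ := fun x => coeff_two_relation μ hμ x
  rcases n with _ | n
  · simp only [compositionSum_product_zero (fun n => coeffMap (μ n) 0) _
      (coeffMap_zero_of_ne_two hred), add_zero] at h
    simp only [h]
    exact Finset.sum_eq_zero fun σ _ => smul_zero _
  · have h2 : ∀ x : Fin (n + 1) → Homogeneous 𝒜, compositionSum (fun n => coeffMap (μ n) 1)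
        (fun n => coeffMap (μ n) 1) (n + 1) (fun i => (extendWord x i).deg)
          (fun i => (extendWord x i).val) = -hochschildCoboundary (coeffMap (μ n) 2) x := by
      intro x
      have h := h x
      rw [compositionSum_product_left (fun n => coeffMap (μ n) 0) _ (coeffMap_zero_two hred)
        (coeffMap_zero_of_ne_two hred),
        compositionSum_product_right (fun n => coeffMap (μ n) 0) _ (coeffMap_zero_two hred)
        (coeffMap_zero_of_ne_two hred)] at h
      exact eq_neg_of_add_eq_zero_left h
    simp only [h2]
    rw [alternation_neg, alternation_hochschildCoboundary hA _
      (hasCochainDegree_coeffMap μ hμ n 2), neg_zero]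

theorem isPInfinity_of_isFirstOrderAlternation (h : IsGradedCommutative 𝒜)
    (hμ : IsAInfinity (FormalSeries.grading 𝒜) μ) (hred : ReducesToProduct μ)
    {l : ∀ n : ℕ, MultilinearMap k (fun _ : Fin n => A) A}
    (hl : IsFirstOrderAlternation 𝒜 μ l) : IsPInfinity 𝒜 l := by
  rw [isFirstOrderAlternation_iff h hred] at hl
  have hword : ∀ {n : ℕ} (d : Fin n → ℤ) (a : Fin n → A), (∀ i, a i ∈ 𝒜 (d i)) →
      ∃ x : Fin n → Homogeneous 𝒜, d = deg ∘ x ∧ a = val ∘ x :=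
    fun d a ha => ⟨fun i => ⟨d i, a i, ha i⟩, rfl, rfl⟩
  have hmem : ∀ (n : ℕ) (x : Fin n → Homogeneous 𝒜),
      l n (val ∘ x) ∈ 𝒜 (∑ i, (x i).deg + 2 - n) := fun n x => by
    rw [hl]
    exact alternate_mem _ (hasCochainDegree_coeffMap μ hμ n 1) x
  refine ⟨h, ?_, ?_, ?_, ?_⟩
  · intro n d a ha
    obtain ⟨x, rfl, rfl⟩ := hword d a ha
    exact hmem n x
  · intro n d a ha i j hij
    obtain ⟨x, rfl, rfl⟩ := hword d a ha
    rcases n with _ | n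
    · exact i.elim0
    obtain ⟨i, rfl⟩ : ∃ i' : Fin n, i = i'.castSucc := ⟨⟨i, by omega⟩, rfl⟩
    obtain rfl : j = i.succ := Fin.ext hij.symm
    rw [Function.comp_assoc, hl, hl, ← Units.neg_smul, alternate, alternate,
      ← alternation_comp_perm deg (Equiv.swap i.castSucc i.succ), altSign_swap_adjacent]
    rfl
  · intro n d a ha
    obtain ⟨x, rfl, rfl⟩ := hword d a ha
    have hval : ∀ y : Homogeneous 𝒜, (l (n + 1)).toLinearMap (Fin.snoc (val ∘ x) 0) (Fin.last n)
        y.val = alternate (coeffMap (μ (n + 1)) 1) (Fin.snoc x y : Fin (n + 1) → Homogeneous 𝒜) := by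
      intro y
      rw [← hl, MultilinearMap.toLinearMap_apply]
      congr 1
      funext i
      refine Fin.lastCases ?_ (fun i => ?_) i <;> simp
    refine ⟨fun j a ha => ?_, fun j a ha b => ?_⟩
    · let y : Homogeneous 𝒜 := ⟨j, a, ha⟩
      have h1 := hmem (n + 1) (Fin.snoc x y)
      rw [hl, ← hval, Fin.sum_univ_castSucc] at h1
      simp only [Fin.snoc_castSucc, Fin.snoc_last] at h1
      have h2 : j + (2 - ((n + 1 : ℕ) : ℤ) + ∑ i, (x i).deg) =
          ∑ i, (x i).deg + j + 2 - ((n + 1 : ℕ) : ℤ) := by ring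
      exact h2 ▸ h1
    -- The Leibniz rule is linear in b, so homogeneous b suffice.
    · have hb : b ∈ ⨆ j, 𝒜 j := by
        rw [h.isInternal.submodule_iSup_eq_top]
        trivial
      induction hb using Submodule.iSup_induction' with
      | mem j' b hb =>
        let y : Homogeneous 𝒜 := ⟨j, a, ha⟩
        let z : Homogeneous 𝒜 := ⟨j', b, hb⟩
        have := alternate_snoc_mul h _ (hasCochainDegree_coeffMap μ hμ (n + 1) 1)
          (hochschildCoboundary_coeffMap_one hμ hred) y z x
        rw [← hval, ← hval, ← hval] at this
        exact this
      | zero => simp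
      | add b c _ _ hb hc =>
        rw [mul_add, map_add, hb, hc, map_add, mul_add, mul_add, smul_add]
        abel
  · intro n d a ha
    obtain ⟨x, rfl, rfl⟩ := hword d a ha
    have h1 := alternation_jacobiator (fun n => coeffMap (μ n) 1) l
      (fun n => hasCochainDegree_coeffMap μ hμ n 1) hl n x
    rw [alternation_compositionSum_coeffMap_one h hμ hred] at h1
    rw [show alternationSum (deg ∘ x) (jacobiator l n) (val ∘ x) = 0 from h1, smul_zero]

end Main

/-! ### The grading of an exterior algebra -/

section ExteriorGrading

variable {V : Type*} [AddCommGroup V] [Module ℝ V]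

theorem exteriorPower_mul_comm (i j : ℕ) {a b : ExteriorAlgebra ℝ V} (ha : a ∈ ⋀[ℝ]^i V)
    (hb : b ∈ ⋀[ℝ]^j V) : a * b = (-1 : ℝ) ^ (i * j) • (b * a) := by
  have h1 : ∀ (v : V) (j : ℕ), ∀ b ∈ ⋀[ℝ]^j V,
      ExteriorAlgebra.ι ℝ v * b = (-1 : ℝ) ^ j • (b * ExteriorAlgebra.ι ℝ v) := by
    intro v j b hb
    induction hb using Submodule.pow_induction_on_left' with
    | algebraMap r => simp [Algebra.commutes]
    | add x y i hx hy ihx ihy => rw [mul_add, add_mul, smul_add, ihx, ihy]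
    | mem_mul m hm i x hx ih =>
      obtain ⟨w, rfl⟩ := hm
      have h2 : ExteriorAlgebra.ι ℝ v * ExteriorAlgebra.ι ℝ w =
          -(ExteriorAlgebra.ι ℝ w * ExteriorAlgebra.ι ℝ v) :=
        eq_neg_of_add_eq_zero_left (ExteriorAlgebra.ι_add_mul_swap v w)
      rw [← mul_assoc, h2, neg_mul, mul_assoc, ih, pow_succ, mul_neg_one, neg_smul,
        mul_smul_comm, mul_assoc]
  induction ha using Submodule.pow_induction_on_left' with
  | algebraMap r => simp [Algebra.commutes]
  | add x y i hx hy ihx ihy => rw [mul_add, add_mul, smul_add, ihx, ihy]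
  | mem_mul m hm i x hx ih =>
    obtain ⟨w, rfl⟩ := hm
    rw [mul_assoc, ih, mul_smul_comm, ← mul_assoc, h1 w j b hb, smul_mul_assoc, smul_smul,
      mul_assoc, ← pow_add, Nat.succ_mul]

theorem exteriorPower_eq_bot_of_finrank_lt [FiniteDimensional ℝ V] {i : ℕ}
    (hi : Module.finrank ℝ V < i) : ⋀[ℝ]^i V = ⊥ := by
  have := exteriorPower.finrank_eq (R := ℝ) (M := V) (n := i)
  rw [Nat.choose_eq_zero_of_lt hi] at this
  exact Submodule.finrank_eq_zero.1 this

/-- The projection of the exterior algebra onto its component of degree `i`. -/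
def exteriorProj (V : Type*) [AddCommGroup V] [Module ℝ V] (i : ℕ) :
    ExteriorAlgebra ℝ V →ₗ[ℝ] ExteriorAlgebra ℝ V :=
  GradedAlgebra.proj (fun i : ℕ => ⋀[ℝ]^i V) i

theorem exteriorProj_mem (i : ℕ) (a : ExteriorAlgebra ℝ V) : exteriorProj V i a ∈ ⋀[ℝ]^i V :=
  (DirectSum.decompose (fun i : ℕ => ⋀[ℝ]^i V) a i).2

theorem exteriorProj_of_mem {i : ℕ} {a : ExteriorAlgebra ℝ V} (ha : a ∈ ⋀[ℝ]^i V) :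
    exteriorProj V i a = a :=
  DirectSum.decompose_of_mem_same (fun i : ℕ => ⋀[ℝ]^i V) ha

theorem exteriorProj_of_mem_ne {i j : ℕ} (hij : i ≠ j) {a : ExteriorAlgebra ℝ V}
    (ha : a ∈ ⋀[ℝ]^i V) : exteriorProj V j a = 0 :=
  DirectSum.decompose_of_mem_ne (fun i : ℕ => ⋀[ℝ]^i V) ha hij

theorem sum_exteriorProj [FiniteDimensional ℝ V] {m : ℕ} (hm : Module.finrank ℝ V < m)
    (a : ExteriorAlgebra ℝ V) : ∑ i ∈ Finset.range m, exteriorProj V i a = a := by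
  classical
  refine Eq.trans ?_ (DirectSum.sum_support_decompose (fun i : ℕ => ⋀[ℝ]^i V) a)
  refine (Finset.sum_subset ?_ ?_).symm
  · intro j hj
    by_contra hjs
    rw [DFinsupp.mem_support_iff] at hj
    have hjm : m ≤ j := by simpa using hjs
    exact hj (Subtype.ext ((Submodule.eq_bot_iff _).1
      (exteriorPower_eq_bot_of_finrank_lt (lt_of_lt_of_le hm hjm)) _
        (DirectSum.decompose (fun i : ℕ => ⋀[ℝ]^i V) a j).2))
  · intro j _ hj
    rw [DFinsupp.notMem_support_iff] at hj
    exact congrArg Subtype.val hj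

variable {W : Type*} [AddCommGroup W] [Module ℝ W]

theorem exteriorAlgebra_map_mem (f : V →ₗ[ℝ] W) {i : ℕ} {a : ExteriorAlgebra ℝ V}
    (ha : a ∈ ⋀[ℝ]^i V) : ExteriorAlgebra.map f a ∈ ⋀[ℝ]^i W := by
  induction ha using Submodule.pow_induction_on_left' with
  | algebraMap r =>
    rw [AlgHom.commutes]
    exact SetLike.algebraMap_mem_graded (fun i : ℕ => ⋀[ℝ]^i W) r
  | add x y i hx hy ihx ihy => rw [map_add]; exact Submodule.add_mem _ ihx ihy
  | mem_mul m hm i x hx ih =>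
    obtain ⟨w, rfl⟩ := hm
    rw [map_mul, ExteriorAlgebra.map_apply_ι]
    change _ ∈ LinearMap.range (ExteriorAlgebra.ι ℝ) ^ (i + 1)
    rw [pow_succ']
    exact Submodule.mul_mem_mul ⟨_, rfl⟩ ih

/-- Induced maps preserve degree. This lets the homogeneous components of a section be read in a
trivialization. -/
theorem exteriorProj_map (f : V →ₗ[ℝ] W) (i : ℕ) (a : ExteriorAlgebra ℝ V) :
    exteriorProj W i (ExteriorAlgebra.map f a) = ExteriorAlgebra.map f (exteriorProj V i a) := by
  classical
  rw [← DirectSum.sum_support_decompose (fun i : ℕ => ⋀[ℝ]^i V) a]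
  simp only [map_sum]
  refine Finset.sum_congr rfl fun j _ => ?_
  have hj := (DirectSum.decompose (fun i : ℕ => ⋀[ℝ]^i V) a j).2
  by_cases h : j = i
  · subst h
    rw [exteriorProj_of_mem hj, exteriorProj_of_mem (exteriorAlgebra_map_mem f hj)]
  · rw [exteriorProj_of_mem_ne h hj, exteriorProj_of_mem_ne h (exteriorAlgebra_map_mem f hj),
      map_zero]

end ExteriorGrading

theorem isInternal_of_projections {ι k A : Type*} [DecidableEq ι] [Ring k] [AddCommGroup A]
    [Module k A] (𝒜 : ι → Submodule k A) (π : ι → A →+ A) (hmem : ∀ j a, π j a ∈ 𝒜 j)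
    (hsame : ∀ j, ∀ a ∈ 𝒜 j, π j a = a) (hne : ∀ i j, i ≠ j → ∀ a ∈ 𝒜 i, π j a = 0)
    (hsum : ∀ a, ∃ s : Finset ι, ∑ j ∈ s, π j a = a) : DirectSum.IsInternal 𝒜 := by
  have hcomp : ∀ (f : DirectSum ι fun i => 𝒜 i) (j : ι),
      π j (DirectSum.coeAddMonoidHom 𝒜 f) = f j := by
    intro f j
    induction f using DirectSum.induction_on with
    | zero => simp
    | of i a =>
      rw [DirectSum.coeAddMonoidHom_of]
      by_cases h : i = j
      · subst h
        rw [hsame _ _ a.2, DirectSum.of_eq_same]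
      · rw [hne i j h _ a.2, DirectSum.of_eq_of_ne _ _ _ (Ne.symm h)]
        rfl
    | add f g hf hg => rw [map_add, map_add, hf, hg]; rfl
  constructor
  · intro f g hfg
    refine DFinsupp.ext fun j => Subtype.ext ?_
    rw [← hcomp, ← hcomp, hfg]
  · intro a
    obtain ⟨s, hs⟩ := hsum a
    refine ⟨∑ j ∈ s, DirectSum.of (fun i => 𝒜 i) j ⟨π j a, hmem j a⟩, ?_⟩
    rw [map_sum]
    simpa only [DirectSum.coeAddMonoidHom_of] using hs

/-! ### Sections of the exterior bundle as a graded commutative algebra -/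

section SectionGrading

theorem fiber_finiteDimensional {M : Type*} [TopologicalSpace M] (F : Type*)
    [NormedAddCommGroup F] [NormedSpace ℝ F] [FiniteDimensional ℝ F]
    (E : M → Type*) [∀ x, AddCommGroup (E x)] [∀ x, Module ℝ (E x)] [∀ x, TopologicalSpace (E x)]
    [TopologicalSpace (Bundle.TotalSpace F E)] [FiberBundle F E] [VectorBundle ℝ F E] (x : M) :
    FiniteDimensional ℝ (E x) :=
  ((trivializationAt F E x).continuousLinearEquivAt ℝ x
    (FiberBundle.mem_baseSet_trivializationAt' x)).symm.toLinearEquiv.finiteDimensional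

variable {EM : Type*} [NormedAddCommGroup EM] [NormedSpace ℝ EM]
  {H : Type*} [TopologicalSpace H] (I : ModelWithCorners ℝ EM H)
  {M : Type*} [TopologicalSpace M] [ChartedSpace H M]
  (F : Type*) [NormedAddCommGroup F] [NormedSpace ℝ F]
  (E : M → Type*) [∀ x, AddCommGroup (E x)] [∀ x, Module ℝ (E x)] [∀ x, TopologicalSpace (E x)]
  [TopologicalSpace (Bundle.TotalSpace F E)] [FiberBundle F E] [VectorBundle ℝ F E]

theorem finrank_fiber (x : M) : Module.finrank ℝ (E x) = Module.finrank ℝ F :=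
  ((trivializationAt F E x).continuousLinearEquivAt ℝ x
    (FiberBundle.mem_baseSet_trivializationAt' x)).toLinearEquiv.finrank_eq

variable {F E}

-- A functional applied to a component of the local form is another functional, composed with the
-- projection, applied to the whole local form.
variable {I} in
theorem IsSmoothSection.exteriorProj {s : ∀ x, ExteriorAlgebra ℝ (E x)}
    (hs : IsSmoothSection I F E s) (i : ℕ) :
    IsSmoothSection I F E fun x => exteriorProj (E x) i (s x) := by
  intro p φ
  refine (hs p (φ ∘ₗ GradedHomotopy.exteriorProj F i)).congr fun x _ => ?_
  rw [localForm, LinearMap.comp_apply, localForm, exteriorProj_map]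

variable [FiniteDimensional ℝ F]


theorem sectionGrading_natCast (i : ℕ) (s : sectionAlgebra I F E) :
    s ∈ sectionGrading I F E (i : ℤ) ↔ ∀ x, s.1 x ∈ ⋀[ℝ]^i (E x) := by
  change (∀ x, s.1 x ∈ if (0 : ℤ) ≤ i then ⋀[ℝ]^(i : ℤ).toNat (E x) else ⊥) ↔ _
  simp

theorem sectionGrading_of_neg {j : ℤ} (hj : j < 0) : sectionGrading I F E j = ⊥ := by
  rw [eq_bot_iff]
  intro s hs
  have hs' : ∀ x, s.1 x ∈ if 0 ≤ j then ⋀[ℝ]^j.toNat (E x) else ⊥ := hs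
  simp only [not_le.2 hj, if_false] at hs'
  exact Subtype.ext (funext fun x => (Submodule.mem_bot ℝ).1 (hs' x))

theorem sectionGrading_of_finrank_lt {j : ℤ} (hj : (Module.finrank ℝ F : ℤ) < j) :
    sectionGrading I F E j = ⊥ := by
  obtain ⟨i, rfl⟩ := Int.eq_ofNat_of_zero_le (a := j) (by omega)
  rw [eq_bot_iff]
  intro s hs
  have hs' := (sectionGrading_natCast I i s).1 hs
  refine Subtype.ext (funext fun x => ?_)
  have := fiber_finiteDimensional F E x
  exact (Submodule.eq_bot_iff _).1 (exteriorPower_eq_bot_of_finrank_lt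
    (by rw [finrank_fiber F E x]; omega)) _ (hs' x)

theorem sectionGrading_eq_bot {j : ℤ} (hj : j ∉ Finset.Icc (0 : ℤ) (Module.finrank ℝ F)) :
    sectionGrading I F E j = ⊥ := by
  by_cases h : j < 0
  · exact sectionGrading_of_neg I h
  · refine sectionGrading_of_finrank_lt I ?_
    rw [Finset.mem_Icc] at hj
    omega

variable (F E) in
/-- The projection onto the sections of degree `j`. -/
def sectionProj (j : ℤ) : sectionAlgebra I F E →+ sectionAlgebra I F E where
  toFun s := if 0 ≤ j then ⟨fun x => exteriorProj (E x) j.toNat (s.1 x),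
    IsSmoothSection.exteriorProj s.2 _⟩ else 0
  map_zero' := by
    split_ifs
    · exact Subtype.ext (funext fun x => map_zero _)
    · rfl
  map_add' s t := by
    split_ifs
    · exact Subtype.ext (funext fun x => map_add _ _ _)
    · rw [add_zero]

theorem sectionProj_natCast (i : ℕ) (s : sectionAlgebra I F E) (x : M) :
    (sectionProj I F E i s).1 x = exteriorProj (E x) i (s.1 x) := by
  change (if (0 : ℤ) ≤ i then (⟨fun x => exteriorProj (E x) (i : ℤ).toNat (s.1 x),
    IsSmoothSection.exteriorProj s.2 _⟩ : sectionAlgebra I F E) else 0).1 x = _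
  rw [if_pos (Int.natCast_nonneg i)]
  rfl

theorem sectionProj_of_neg {j : ℤ} (hj : j < 0) (s : sectionAlgebra I F E) :
    sectionProj I F E j s = 0 := if_neg (not_le.2 hj)

theorem isInternal_sectionGrading : DirectSum.IsInternal (sectionGrading I F E) := by
  refine isInternal_of_projections _ (sectionProj I F E) ?_ ?_ ?_ ?_
  · intro j s
    by_cases hj : j < 0
    · rw [sectionProj_of_neg I hj]
      exact Submodule.zero_mem _
    · obtain ⟨i, rfl⟩ := Int.eq_ofNat_of_zero_le (not_lt.1 hj)
      rw [sectionGrading_natCast]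
      intro x
      rw [sectionProj_natCast]
      exact exteriorProj_mem _ _
  · intro j s hs
    by_cases hj : j < 0
    · rw [sectionGrading_of_neg I hj, Submodule.mem_bot] at hs
      rw [hs, map_zero]
    · obtain ⟨i, rfl⟩ := Int.eq_ofNat_of_zero_le (not_lt.1 hj)
      rw [sectionGrading_natCast] at hs
      refine Subtype.ext (funext fun x => ?_)
      rw [sectionProj_natCast]
      exact exteriorProj_of_mem (hs x)
  · intro i j hij s hs
    by_cases hj : j < 0
    · rw [sectionProj_of_neg I hj]
    by_cases hi : i < 0
    · rw [sectionGrading_of_neg I hi, Submodule.mem_bot] at hs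
      rw [hs, map_zero]
    obtain ⟨i, rfl⟩ := Int.eq_ofNat_of_zero_le (not_lt.1 hi)
    obtain ⟨j, rfl⟩ := Int.eq_ofNat_of_zero_le (not_lt.1 hj)
    rw [sectionGrading_natCast] at hs
    refine Subtype.ext (funext fun x => ?_)
    rw [sectionProj_natCast]
    exact exteriorProj_of_mem_ne (by exact_mod_cast hij) (hs x)
  · intro s
    -- Fibres have the rank of F, so one finite set of degrees works at all points at once.
    refine ⟨(Finset.range (Module.finrank ℝ F + 1)).map Nat.castEmbedding, ?_⟩
    rw [Finset.sum_map]
    refine Subtype.ext (funext fun x => ?_)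
    have := fiber_finiteDimensional F E x
    refine Eq.trans ?_ (sum_exteriorProj (V := E x) (m := Module.finrank ℝ F + 1)
      (by rw [finrank_fiber F E x]; omega) (s.1 x))
    rw [AddSubmonoidClass.coe_finsetSum, Finset.sum_apply]
    exact Finset.sum_congr rfl fun i _ => sectionProj_natCast I i s x

theorem sectionGrading_isGradedCommutative :
    IsGradedCommutative (sectionGrading I F E) where
  isInternal := isInternal_sectionGrading I
  one_mem := by
    rw [← Nat.cast_zero, sectionGrading_natCast]
    intro x
    exact SetLike.GradedOne.one_mem (A := fun i : ℕ => ⋀[ℝ]^i (E x))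
  mul_mem i j a ha b hb := by
    by_cases hi : i < 0
    · rw [sectionGrading_of_neg I hi, Submodule.mem_bot] at ha
      rw [ha, zero_mul]
      exact Submodule.zero_mem _
    by_cases hj : j < 0
    · rw [sectionGrading_of_neg I hj, Submodule.mem_bot] at hb
      rw [hb, mul_zero]
      exact Submodule.zero_mem _
    obtain ⟨i, rfl⟩ := Int.eq_ofNat_of_zero_le (not_lt.1 hi)
    obtain ⟨j, rfl⟩ := Int.eq_ofNat_of_zero_le (not_lt.1 hj)
    rw [sectionGrading_natCast] at ha hb
    rw [← Nat.cast_add, sectionGrading_natCast]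
    intro x
    exact SetLike.GradedMul.mul_mem (A := fun i : ℕ => ⋀[ℝ]^i (E x)) (ha x) (hb x)
  mul_comm i j a ha b hb := by
    by_cases hi : i < 0
    · rw [sectionGrading_of_neg I hi, Submodule.mem_bot] at ha
      rw [ha, zero_mul, mul_zero, smul_zero]
    by_cases hj : j < 0
    · rw [sectionGrading_of_neg I hj, Submodule.mem_bot] at hb
      rw [hb, zero_mul, mul_zero, smul_zero]
    obtain ⟨i, rfl⟩ := Int.eq_ofNat_of_zero_le (not_lt.1 hi)
    obtain ⟨j, rfl⟩ := Int.eq_ofNat_of_zero_le (not_lt.1 hj)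
    rw [sectionGrading_natCast] at ha hb
    rw [← Nat.cast_mul, negOnePow_natCast_smul (k := ℝ)]
    exact Subtype.ext (funext fun x => exteriorPower_mul_comm i j (ha x) (hb x))

end SectionGrading

end GradedHomotopy

end

theorem mainTheorem12
    {EM : Type*} [NormedAddCommGroup EM] [NormedSpace ℝ EM] [FiniteDimensional ℝ EM]
    {H : Type*} [TopologicalSpace H] (I : ModelWithCorners ℝ EM H) [I.Boundaryless]
    {M : Type*} [TopologicalSpace M] [T2Space M] [SecondCountableTopology M]
    [ChartedSpace H M] [IsManifold I ∞ M]
    (F : Type*) [NormedAddCommGroup F] [NormedSpace ℝ F] [FiniteDimensional ℝ F]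
    (E : M → Type*) [∀ x, AddCommGroup (E x)] [∀ x, Module ℝ (E x)]
    [∀ x, TopologicalSpace (E x)] [TopologicalSpace (Bundle.TotalSpace F E)]
    [FiberBundle F E] [VectorBundle ℝ F E] [ContMDiffVectorBundle ∞ F E I]
    (μ : ∀ n : ℕ, MultilinearMap (PowerSeries ℝ)
      (fun _ : Fin n => GradedHomotopy.FormalSeries (GradedHomotopy.sectionAlgebra I F E))
      (GradedHomotopy.FormalSeries (GradedHomotopy.sectionAlgebra I F E)))
    (hμ : GradedHomotopy.IsAInfinity
      (GradedHomotopy.FormalSeries.grading (GradedHomotopy.sectionGrading I F E)) μ)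
    (hred : GradedHomotopy.ReducesToProduct μ)
    (hdiff : GradedHomotopy.IsMultidifferential (GradedHomotopy.sectionGrading I F E) μ) :
    (∃! l : ∀ n : ℕ, MultilinearMap ℝ
        (fun _ : Fin n => GradedHomotopy.sectionAlgebra I F E)
        (GradedHomotopy.sectionAlgebra I F E),
      GradedHomotopy.IsFirstOrderAlternation (GradedHomotopy.sectionGrading I F E) μ l) ∧
    ∀ l : ∀ n : ℕ, MultilinearMap ℝ
        (fun _ : Fin n => GradedHomotopy.sectionAlgebra I F E)
        (GradedHomotopy.sectionAlgebra I F E),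
      GradedHomotopy.IsFirstOrderAlternation (GradedHomotopy.sectionGrading I F E) μ l →
        GradedHomotopy.IsPInfinity (GradedHomotopy.sectionGrading I F E) l := by
  have h := GradedHomotopy.sectionGrading_isGradedCommutative (F := F) (E := E) I
  exact ⟨GradedHomotopy.existsUnique_isFirstOrderAlternation h _
    (fun _ hj => GradedHomotopy.sectionGrading_eq_bot I hj) hred,
    fun _ hl => GradedHomotopy.isPInfinity_of_isFirstOrderAlternation h hμ hred hl⟩
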